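/- Let $E$ be a Hausdorff sequentially complete locally convex space over $\mathbb{C}$, let $L(E)$ be the space of continuous linear operators on $E$ with the topology of uniform convergence on bounded sets, and let $C\in L(E)$. Let $\mathcal{T}$ be one of the following spaces of test functions $\mathbb{R}\to\mathbb{C}$: the Schwartz space $\mathcal{D}=C_0^\infty(\mathbb{R})$, the Beurling space $\mathcal{D}^{(M_p)}$, or the Roumieu space $\mathcal{D}^{\{M_p\}}$, each with its usual (locally convex inductive limit) topology, where $(M_p)$ is a sequence of positive numbers with $M_0=1$ satisfying (M.1) $M_p^2\le M_{p-1}M_{p+1}$ for $p\ge1$, (M.2) $M_{p+q}\le AH^{p+q}M_pM_q$ for some $A,H>0$ and all $p,q\geq 0$, and (M.3)' $\sum_{p\ge1}M_{p-1}/M_p<\infty$. Here $\mathcal{D}^{(M_p)}$ (resp. $\mathcal{D}^{\{M_p\}}$) consists of the compactly supported smooth $\varphi$ with $\sup_{p,t}h^p|\varphi^{(p)}(t)|/M_p<\infty$ for every (resp. some) $h>0$. Let $\mathcal{T}_0=\{\varphi\in\mathcal{T}:\operatorname{supp}\varphi\subseteq[0,\infty)\}$, and let $\mathcal{T}'_0(L(E))$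 be the set of continuous linear maps $\mathcal{G}:\mathcal{T}\to L(E)$ supported in $[0,\infty)$, i.e. with $\mathcal{G}(\varphi)=0$ whenever $\operatorname{supp}\varphi\subseteq(-\infty,0)$. Such a $\mathcal{G}$ is called boundedly equicontinuous if for every continuous seminorm $p$ on $E$ and every bounded $B\subseteq\mathcal{T}$ there are $c>0$ and a continuous seminorm $q$ on $E$ with $p(\mathcal{G}(\varphi)x)\le c\,q(x)$ for all $\varphi\in B$, $x\in E$. Write $\mathcal{G}C=C\mathcal{G}$ if $\mathcal{G}(\varphi)C=C\mathcal{G}(\varphi)$ for all $\varphi\in\mathcal{T}$. Put $(\varphi*\psi)(t)=\int_{-\infty}^{\infty}\varphi(t-s)\psi(s)\,ds$, $(\varphi*_0\psi)(t)=\int_0^t\varphi(t-s)\psi(s)\,ds$, $\mathcal{N}(\mathcal{G})=\bigcap_{\varphi\in\mathcal{T}_0}\ker\mathcal{G}(\varphi)$ and $\mathcal{R}(\mathcal{G})=\bigcup_{\varphi\in\mathcal{T}_0}\operatorname{ran}\mathcal{G}(\varphi)$. A boundedly equicontinuous $\mathcal{G}\in\mathcal{T}'_0(L(E))$ with $\mathcal{G}C=C\mathcal{G}$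 is called a $C$-distribution semigroup if $\mathcal{T}=\mathcal{D}$, resp. a $C$-ultradistribution semigroup (of Beurling or Roumieu class) otherwise, if $\mathcal{G}(\varphi*_0\psi)C=\mathcal{G}(\varphi)\mathcal{G}(\psi)$ for all $\varphi,\psi\in\mathcal{T}$ and $\mathcal{N}(\mathcal{G})=\{0\}$. For $\psi\in\mathcal{T}$ let $\psi_+=\psi\mathbf{1}_{[0,\infty)}$, and let $G(\psi_+)$ be the operator with graph $\{(x,y)\in E\times E:\mathcal{G}(\psi_+*\varphi)x=\mathcal{G}(\varphi)y\ \text{for all}\ \varphi\in\mathcal{T}_0\}$ (it is single-valued if $\mathcal{N}(\mathcal{G})=\{0\}$). Consider the conditions - $(d_1)$ $\mathcal{G}(\varphi*\psi)C=\mathcal{G}(\varphi)\mathcal{G}(\psi)$ for all $\varphi,\psi\in\mathcal{T}_0$; - $(d_2)$ $\mathcal{N}(\mathcal{G})=\{0\}$; - $(d_3)$ $\mathcal{R}(\mathcal{G})$ is dense in $E$; - $(d_4)$ for every $x\in\mathcal{R}(\mathcal{G})$ there is a continuous $u_x:[0,\infty)\to E$ with $u_x(0)=Cx$ and $\mathcal{G}(\varphi)x=\int_0^\infty\varphi(t)u_x(t)\,dt$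 for all $\varphi\in\mathcal{T}$; - $(d_5)$ (when $(d_2)$ holds) $G(\psi_+)C=\mathcal{G}(\psi)$ for all $\psi\in\mathcal{T}$. Theorem. In each of the three cases for $\mathcal{T}$: (i) If $\mathcal{G}\in\mathcal{T}'_0(L(E))$ is boundedly equicontinuous and $\mathcal{G}C=C\mathcal{G}$, then $\mathcal{G}$ is a $C$-distribution semigroup (resp. $C$-ultradistribution semigroup) if and only if $(d_1)$, $(d_2)$ and $(d_5)$ hold. (ii) If $\mathcal{G}\in\mathcal{T}'_0(L(E))$ is boundedly equicontinuous, $\mathcal{G}C=C\mathcal{G}$, and $(d_1)$, $(d_2)$, $(d_3)$, $(d_4)$ hold, then $\mathcal{G}$ is a $C$-distribution semigroup (resp. $C$-ultradistribution semigroup). (iii) Every $C$-distribution semigroup (resp. $C$-ultradistribution semigroup) satisfies $(d_4)$. -/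

import Mathlib

open scoped Distributions NNReal Topology ContDiff
open Set Filter MeasureTheory

namespace CDS

/-! ### Ultradifferentiable test functions on `ℝ` -/

/-- The conditions (M.1), (M.2), (M.3)' on a weight sequence `(M_p)`, normalized by `M_0 = 1`. -/
structure IsWeightSequence (M : ℕ → ℝ) : Prop where
  pos : ∀ p, 0 < M p
  zero : M 0 = 1
  logConvex : ∀ p, M (p + 1) ^ 2 ≤ M p * M (p + 2)
  stable : ∃ A > 0, ∃ H > 0, ∀ p q, M (p + q) ≤ A * H ^ (p + q) * (M p * M q)
  nonQuasiAnalytic : Summable fun p => M p / M (p + 1)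

/-- The two classes of ultradifferentiable functions: Beurling `(M_p)` and Roumieu `{M_p}`. -/
inductive UltraClass
  | beurling
  | roumieu

/-- `sup { h^p |φ^{(p)}(t)| / M_p : t ∈ ℝ, p ∈ ℕ }`, with values in `[0, ∞]`. (For `φ` with support
in `K` the supremum over `t ∈ K` is the same.) -/
noncomputable def ultraNorm (M : ℕ → ℝ) (h : ℝ) (φ : ℝ → ℂ) : ENNReal :=
  ⨆ (p : ℕ) (t : ℝ), ENNReal.ofReal (h ^ p / M p) * ‖iteratedDeriv p φ t‖ₑ

/-- Finiteness of the norms: for all `h > 0` (Beurling), for some `h > 0` (Roumieu). -/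
def UltraBounded (M : ℕ → ℝ) (φ : ℝ → ℂ) : UltraClass → Prop
  | .beurling => ∀ h > 0, ultraNorm M h φ < ⊤
  | .roumieu => ∃ h > 0, ultraNorm M h φ < ⊤

theorem ultraNorm_zero (M : ℕ → ℝ) (h : ℝ) : ultraNorm M h 0 = 0 := by
  simp [ultraNorm]

theorem ultraNorm_add_le (M : ℕ → ℝ) (h : ℝ) {φ ψ : ℝ → ℂ} (hφ : ContDiff ℝ ∞ φ)
    (hψ : ContDiff ℝ ∞ ψ) : ultraNorm M h (φ + ψ) ≤ ultraNorm M h φ + ultraNorm M h ψ := by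
  refine iSup₂_le fun p t => ?_
  have hp : (p : WithTop ℕ∞) ≤ ∞ := by exact_mod_cast le_top
  rw [iteratedDeriv_add ((hφ.of_le hp).contDiffAt) ((hψ.of_le hp).contDiffAt)]
  refine (mul_le_mul_right (enorm_add_le _ _) _).trans ?_
  rw [mul_add]
  exact add_le_add
    (le_iSup₂ (f := fun p t => ENNReal.ofReal (h ^ p / M p) * ‖iteratedDeriv p φ t‖ₑ) p t)
    (le_iSup₂ (f := fun p t => ENNReal.ofReal (h ^ p / M p) * ‖iteratedDeriv p ψ t‖ₑ) p t)

theorem ultraNorm_smul_le (M : ℕ → ℝ) (h : ℝ) (c : ℂ) {φ : ℝ → ℂ} (hφ : ContDiff ℝ ∞ φ) :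
    ultraNorm M h (c • φ) ≤ ‖c‖ₑ * ultraNorm M h φ := by
  refine iSup₂_le fun p t => ?_
  have hp : (p : WithTop ℕ∞) ≤ ∞ := by exact_mod_cast le_top
  rw [iteratedDeriv_const_smul ((hφ.of_le hp).contDiffAt) c, enorm_smul, mul_left_comm]
  gcongr
  exact le_iSup₂ (f := fun p t => ENNReal.ofReal (h ^ p / M p) * ‖iteratedDeriv p φ t‖ₑ) p t

theorem ultraNorm_mono {M : ℕ → ℝ} (hM : ∀ p, 0 < M p) {h k : ℝ} (h0 : 0 ≤ h) (hk : h ≤ k)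
    (φ : ℝ → ℂ) : ultraNorm M h φ ≤ ultraNorm M k φ := by
  refine iSup₂_mono fun p t => ?_
  have := (hM p).le
  gcongr

/-- A weight sequence together with its defining conditions. -/
structure Weight where
  seq : ℕ → ℝ
  isWeight : IsWeightSequence seq

/-- The vector space of compactly supported ultradifferentiable functions of class `κ`. -/
def ultraSubmodule (κ : UltraClass) (M : Weight) : Submodule ℂ (ℝ → ℂ) where
  carrier := {φ | ContDiff ℝ ∞ φ ∧ HasCompactSupport φ ∧ UltraBounded M.seq φ κ}
  zero_mem' := by
    refine ⟨contDiff_const, HasCompactSupport.zero, ?_⟩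
    cases κ
    · intro h _; rw [ultraNorm_zero]; simp
    · exact ⟨1, one_pos, by rw [ultraNorm_zero]; simp⟩
  add_mem' := by
    rintro φ ψ ⟨h1, h2, h3⟩ ⟨k1, k2, k3⟩
    refine ⟨h1.add k1, h2.add k2, ?_⟩
    cases κ
    · intro h hh
      exact (ultraNorm_add_le _ _ h1 k1).trans_lt (ENNReal.add_lt_top.2 ⟨h3 h hh, k3 h hh⟩)
    · obtain ⟨h, hh, hb⟩ := h3
      obtain ⟨k, hk, kb⟩ := k3
      have hm : 0 < min h k := lt_min hh hk
      refine ⟨min h k, hm, (ultraNorm_add_le _ _ h1 k1).trans_lt (ENNReal.add_lt_top.2 ⟨?_, ?_⟩)⟩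
      · exact (ultraNorm_mono M.isWeight.pos hm.le (min_le_left _ _) _).trans_lt hb
      · exact (ultraNorm_mono M.isWeight.pos hm.le (min_le_right _ _) _).trans_lt kb
  smul_mem' := by
    rintro c φ ⟨h1, h2, h3⟩
    refine ⟨contDiff_const.smul h1, h2.smul_left (f := fun _ => c), ?_⟩
    cases κ
    · intro h hh
      exact (ultraNorm_smul_le _ _ c h1).trans_lt (ENNReal.mul_lt_top enorm_lt_top (h3 h hh))
    · obtain ⟨h, hh, hb⟩ := h3
      exact ⟨h, hh, (ultraNorm_smul_le _ _ c h1).trans_lt (ENNReal.mul_lt_top enorm_lt_top hb)⟩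

/-- The space `𝒟^{(M_p)}` (Beurling) or `𝒟^{{M_p}}` (Roumieu) of test functions on `ℝ`. -/
def UltraTestFunction (κ : UltraClass) (M : Weight) : Type := ultraSubmodule κ M

namespace UltraTestFunction

variable (κ : UltraClass) (M : Weight)

noncomputable instance : AddCommGroup (UltraTestFunction κ M) :=
  inferInstanceAs (AddCommGroup (ultraSubmodule κ M))

noncomputable instance : Module ℂ (UltraTestFunction κ M) :=
  inferInstanceAs (Module ℂ (ultraSubmodule κ M))

instance : FunLike (UltraTestFunction κ M) ℝ ℂ where
  coe φ := φ.1
  coe_injective := Subtype.val_injective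

/-- A seminorm on the test space whose restrictions to all the steps of the inductive limit are
continuous. Beurling: the steps are `𝒟_K = projlim_{h → ∞} 𝒟_K^{M_p,h}`, `K` compact. Roumieu: the
steps are the normed spaces `𝒟_K^{M_p,h}`, `K` compact, `h > 0`. -/
def StepContinuous {M : Weight} :
    (κ : UltraClass) → Seminorm ℂ (UltraTestFunction κ M) → Prop
  | .beurling, q => ∀ K : Set ℝ, IsCompact K → ∃ h > 0, ∃ c : ℝ≥0,
      ∀ φ : UltraTestFunction .beurling M, tsupport φ ⊆ K →
        ENNReal.ofReal (q φ) ≤ c * ultraNorm M.seq h φ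
  | .roumieu, q => ∀ K : Set ℝ, IsCompact K → ∀ h > 0, ∃ c : ℝ≥0,
      ∀ φ : UltraTestFunction .roumieu M, tsupport φ ⊆ K → ultraNorm M.seq h φ < ⊤ →
        ENNReal.ofReal (q φ) ≤ c * ultraNorm M.seq h φ

/-- All step-continuous seminorms. -/
def seminormFamily : SeminormFamily ℂ (UltraTestFunction κ M)
    {q : Seminorm ℂ (UltraTestFunction κ M) // StepContinuous κ q} := fun q => q.1

instance : Nonempty {q : Seminorm ℂ (UltraTestFunction κ M) // StepContinuous κ q} :=
  ⟨⟨0, by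
    cases κ
    · exact fun K _ => ⟨1, one_pos, 0, fun φ _ => by simp⟩
    · exact fun K _ h _ => ⟨0, fun φ _ _ => by simp⟩⟩⟩

/-- The locally convex inductive limit topology: it is generated by the seminorms which are
continuous on every step. -/
noncomputable instance : TopologicalSpace (UltraTestFunction κ M) :=
  (seminormFamily κ M).moduleFilterBasis.topology

theorem withSeminorms : WithSeminorms (seminormFamily κ M) := ⟨rfl⟩

end UltraTestFunction

/-! ### Operator-valued (ultra)distributions and `C`-(ultra)distribution semigroups

Everything below is stated for a space `𝒯` of test functions `ℝ → ℂ`, to be taken to be `𝒟`,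
`𝒟^{(M_p)}` or `𝒟^{{M_p}}`; an `L(E)`-valued (ultra)distribution is a continuous linear map
`𝒯 → L(E)`, where `L(E)` carries the topology of uniform convergence on bounded sets. -/

/-- `φ * ψ`. -/
noncomputable def conv (φ ψ : ℝ → ℂ) (t : ℝ) : ℂ := ∫ s, φ (t - s) * ψ s

/-- `φ *₀ ψ`. -/
noncomputable def conv₀ (φ ψ : ℝ → ℂ) (t : ℝ) : ℂ := ∫ s in (0 : ℝ)..t, φ (t - s) * ψ s

/-- `ψ₊ = ψ 1_{[0,∞)}`. -/
noncomputable def plus (ψ : ℝ → ℂ) : ℝ → ℂ := (Ici (0 : ℝ)).indicator ψ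

section

variable {𝒯 : Type*} [AddCommGroup 𝒯] [Module ℂ 𝒯] [TopologicalSpace 𝒯] [FunLike 𝒯 ℝ ℂ]
  {E : Type*} [AddCommGroup E] [Module ℂ E] [UniformSpace E] [IsUniformAddGroup E]
  [ContinuousSMul ℂ E]

/-- The test functions with support in `[0,∞)`. -/
def testNonneg (𝒯 : Type*) [FunLike 𝒯 ℝ ℂ] : Set 𝒯 := {φ | tsupport φ ⊆ Ici 0}

/-- `supp 𝒢 ⊆ [0,∞)`: `𝒢` vanishes on the test functions supported in `(-∞,0)`. -/
def SupportedNonneg (G : 𝒯 →L[ℂ] (E →L[ℂ] E)) : Prop :=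
  ∀ φ : 𝒯, tsupport φ ⊆ Iio 0 → G φ = 0

def BoundedlyEquicontinuous (G : 𝒯 →L[ℂ] (E →L[ℂ] E)) : Prop :=
  ∀ p : Seminorm ℂ E, Continuous p → ∀ B : Set 𝒯, Bornology.IsVonNBounded ℂ B →
    ∃ c > 0, ∃ q : Seminorm ℂ E, Continuous q ∧ ∀ φ ∈ B, ∀ x, p (G φ x) ≤ c * q x

/-- `𝒢 C = C 𝒢`. -/
def Commutes (G : 𝒯 →L[ℂ] (E →L[ℂ] E)) (C : E →L[ℂ] E) : Prop :=
  ∀ φ : 𝒯, (G φ).comp C = C.comp (G φ)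

/-- `𝒢(φ *₀ ψ) C = 𝒢(φ) 𝒢(ψ)` for all test functions `φ, ψ`, where `χ` is the function
`φ *₀ ψ` as an element of `𝒯`. -/
def CS1 (G : 𝒯 →L[ℂ] (E →L[ℂ] E)) (C : E →L[ℂ] E) : Prop :=
  ∀ φ ψ : 𝒯, ∃ χ : 𝒯, ⇑χ = conv₀ φ ψ ∧ (G χ).comp C = (G φ).comp (G ψ)

/-- `𝒩(𝒢)`: the intersection of the kernels of `𝒢(φ)`, `φ` supported in `[0,∞)`. -/
def kernel (G : 𝒯 →L[ℂ] (E →L[ℂ] E)) : Set E := {x | ∀ φ ∈ testNonneg 𝒯, G φ x = 0}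

/-- `ℛ(𝒢)`: the union of the ranges of `𝒢(φ)`, `φ` supported in `[0,∞)`. -/
def range (G : 𝒯 →L[ℂ] (E →L[ℂ] E)) : Set E := {y | ∃ φ ∈ testNonneg 𝒯, ∃ x, G φ x = y}

/-- `𝒩(𝒢) = {0}`. -/
def CS2 (G : 𝒯 →L[ℂ] (E →L[ℂ] E)) : Prop := kernel G = {0}

/-- `C`-distribution semigroups (`C`-ultradistribution semigroups of `*`-class). -/
structure IsCSemigroup (G : 𝒯 →L[ℂ] (E →L[ℂ] E)) (C : E →L[ℂ] E) : Prop where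
  supported : SupportedNonneg G
  commutes : Commutes G C
  boundedlyEquicontinuous : BoundedlyEquicontinuous G
  cs1 : CS1 G C
  cs2 : CS2 G

/-- The operator `G(T)`, as a subset of `E × E`, for `T` the regular (ultra)distribution given by a
locally integrable function `f` with compact support in `[0,∞)`: the pairs `(x, y)` with
`𝒢(f * φ) x = 𝒢(φ) y` for all test functions `φ` supported in `[0,∞)`. -/
def opOf (G : 𝒯 →L[ℂ] (E →L[ℂ] E)) (f : ℝ → ℂ) : Set (E × E) :=
  {z | ∀ φ ∈ testNonneg 𝒯, ∃ χ : 𝒯, ⇑χ = conv f φ ∧ G χ z.1 = G φ z.2}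

/-- `∫_S f = y` for a function `f` with values in a Hausdorff locally convex space, in the weak
sense. -/
def HasIntegral (f : ℝ → E) (S : Set ℝ) (y : E) : Prop :=
  ∀ l : E →L[ℂ] ℂ, IntegrableOn (fun t => l (f t)) S ∧ ∫ t in S, l (f t) = l y

def D1 (G : 𝒯 →L[ℂ] (E →L[ℂ] E)) (C : E →L[ℂ] E) : Prop :=
  ∀ φ ∈ testNonneg 𝒯, ∀ ψ ∈ testNonneg 𝒯,
    ∃ χ : 𝒯, ⇑χ = conv φ ψ ∧ (G χ).comp C = (G φ).comp (G ψ)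

def D2 (G : 𝒯 →L[ℂ] (E →L[ℂ] E)) : Prop := CS2 G

def D3 (G : 𝒯 →L[ℂ] (E →L[ℂ] E)) : Prop := Dense (range G)

def D4 (G : 𝒯 →L[ℂ] (E →L[ℂ] E)) (C : E →L[ℂ] E) : Prop :=
  ∀ x ∈ range G, ∃ u : ℝ → E, ContinuousOn u (Ici 0) ∧ u 0 = C x ∧
    ∀ φ : 𝒯, HasIntegral (fun t => φ t • u t) (Ici 0) (G φ x)

/-- `G(ψ₊) C = 𝒢(ψ)` for all test functions `ψ`, as an equality of (graphs of) operators on `E`. -/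
def D5 (G : 𝒯 →L[ℂ] (E →L[ℂ] E)) (C : E →L[ℂ] E) : Prop :=
  ∀ ψ : 𝒯, {z : E × E | (C z.1, z.2) ∈ opOf G (plus ψ)} = {z : E × E | z.2 = G ψ z.1}

end

end CDS

namespace CDS

/-! ### Calculus of the truncated convolution -/

/-! The argument uses only a few properties of the test space, collected in `TestSpace`: smoothness,
compact support, closure under translation, multiplication by `t` and `*₀`, and a criterion for
sequential convergence that may lose one derivative. They are checked for `𝒟` and for both
ultradifferentiable classes; `testSpace_main` does the rest.

For `η` supported in `[0,∞)` one has `ψ₊ * η = ψ *₀ η`, so `(d₅)` is the semigroup identity with one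
factor supported in `[0,∞)`, since `𝒩(𝒢) = {0}` allows cancelling `𝒢(η)` (`CS1.d5`, `D5.cs1`). The
identity for arbitrary factors follows by applying another `𝒢(η)`, using associativity of `*₀`, and
cancelling (`cs1_of_forall_testNonneg`).

For (ii), let `x ∈ ℛ(𝒢)` be represented by `u`, let `ζ` be supported in `[0,∞)`, and let `l` be a
continuous functional. Then `l(𝒢(ζ)𝒢(ψ)x)` and `l(𝒢(ψ *₀ ζ)Cx)` are integrals of `ψ` over `[0,∞)`
against continuous functions, by Fubini for the second. By `(d₁)` they agree when `ψ` is supported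
in `[0,∞)`; such functions separate, so the two densities coincide and the identity holds for every
`ψ` (`D4.apply_apply_of_mem_range`). Density of `ℛ(𝒢)` gives all `x`.

For (iii), if `x = 𝒢(ζ)y`, take `u(s) = 𝒢(ζ(· - s))Cy`. Riemann sums of translates of `ζ` converge
to `φ *₀ ζ` in the test space, so continuity of `𝒢` gives `∫ φ u = 𝒢(φ *₀ ζ)Cy = 𝒢(φ)x` (`CS1.d4`).
-/

theorem conv₀_comm (φ ψ : ℝ → ℂ) : conv₀ φ ψ = conv₀ ψ φ := by
  funext t
  have := intervalIntegral.integral_comp_sub_left (fun s => φ s * ψ (t - s)) (a := 0) (b := t) t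
  simp only [sub_sub_cancel, sub_self, sub_zero] at this
  simp only [conv₀]
  rw [this]
  exact intervalIntegral.integral_congr fun s _ => mul_comm _ _

/-- The variable occurs both as endpoint and in the integrand. Decoupled into two variables, the
integral has continuous partial derivatives, hence a joint derivative, which is composed with the
diagonal. -/
theorem hasDerivAt_conv₀ {φ ψ : ℝ → ℂ} (hφ : ContDiff ℝ 1 φ) (hψ : Continuous ψ) (t : ℝ) :
    HasDerivAt (conv₀ φ ψ) (φ 0 * ψ t + conv₀ (deriv φ) ψ t) t := by
  have hφc : Continuous φ := hφ.continuous
  have hd : Continuous (deriv φ) := hφ.continuous_deriv le_rfl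
  let f : ℝ → ℝ → ℂ := fun a x => ∫ s in (0 : ℝ)..a, φ (x - s) * ψ s
  have h1 : ∀ a x, HasDerivAt (fun a => f a x) (φ (x - a) * ψ a) a := fun a x =>
    (show Continuous fun s => φ (x - s) * ψ s by fun_prop).integral_hasStrictDerivAt 0 a
      |>.hasDerivAt
  have h2 : ∀ a x, HasDerivAt (f a) (∫ s in (0 : ℝ)..a, deriv φ (x - s) * ψ s) x := by
    intro a x
    have hcont : Continuous fun q : ℝ × ℝ => deriv φ (q.1 - q.2) * ψ q.2 := by fun_prop
    obtain ⟨B, hB⟩ := ((isCompact_closedBall x 1).prod (isCompact_uIcc (a := (0 : ℝ))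
      (b := a))).exists_bound_of_continuousOn hcont.continuousOn
    refine (intervalIntegral.hasDerivAt_integral_of_dominated_loc_of_deriv_le
      (F := fun x s => φ (x - s) * ψ s) (F' := fun x s => deriv φ (x - s) * ψ s)
      (bound := fun _ => B) (Metric.closedBall_mem_nhds x one_pos)
      (Eventually.of_forall fun y => ?_) ?_ ?_ ?_ ?_ ?_).2
    · exact Continuous.aestronglyMeasurable (by fun_prop)
    · exact Continuous.intervalIntegrable (by fun_prop) _ _
    · exact Continuous.aestronglyMeasurable (by fun_prop)
    · exact Eventually.of_forall fun s hs y hy => hB (y, s) ⟨hy, uIoc_subset_uIcc hs⟩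
    · exact intervalIntegrable_const
    · refine Eventually.of_forall fun s _ y _ => ?_
      have := ((hφ.differentiable one_ne_zero) (y - s)).hasDerivAt
      exact (this.comp_sub_const y s).mul_const _
  have key := hasStrictFDerivAt_uncurry_coprod (𝕜 := ℝ) (u := (t, t)) (f := f)
    (f₁ := fun a x => ContinuousLinearMap.toSpanSingleton ℝ (φ (x - a) * ψ a))
    (f₂ := fun a x => ContinuousLinearMap.toSpanSingleton ℝ
      (∫ s in (0 : ℝ)..a, deriv φ (x - s) * ψ s))
    (Eventually.of_forall fun v => (h1 v.1 v.2).hasFDerivAt)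
    (Eventually.of_forall fun v => (h2 v.1 v.2).hasFDerivAt)
    (by
      refine Continuous.continuousAt ?_
      refine (ContinuousLinearMap.toSpanSingletonCLE (𝕜 := ℝ) (E := ℂ)).continuous.comp ?_
      fun_prop)
    (by
      refine Continuous.continuousAt ?_
      refine (ContinuousLinearMap.toSpanSingletonCLE (𝕜 := ℝ) (E := ℂ)).continuous.comp ?_
      exact intervalIntegral.continuous_parametric_intervalIntegral_of_continuous
        (f := fun (q : ℝ × ℝ) s => deriv φ (q.2 - s) * ψ s) (by fun_prop) continuous_fst)
  have hdiag : HasDerivAt (fun x : ℝ => (x, x)) ((1 : ℝ), (1 : ℝ)) t :=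
    (hasDerivAt_id t).prodMk (hasDerivAt_id t)
  have := HasFDerivAt.comp_hasDerivAt (f := fun x : ℝ => (x, x)) t key.hasFDerivAt hdiag
  change HasDerivAt (fun x => conv₀ φ ψ x) _ t
  simpa [conv₀, Function.HasUncurry.uncurry, f, Function.comp_def] using this

theorem deriv_conv₀ {φ ψ : ℝ → ℂ} (hφ : ContDiff ℝ 1 φ) (hψ : Continuous ψ) :
    deriv (conv₀ φ ψ) = φ 0 • ψ + conv₀ (deriv φ) ψ :=
  funext fun t => (hasDerivAt_conv₀ hφ hψ t).deriv

theorem contDiff_conv₀ {φ ψ : ℝ → ℂ} (hφ : ContDiff ℝ ∞ φ) (hψ : ContDiff ℝ ∞ ψ) :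
    ContDiff ℝ ∞ (conv₀ φ ψ) := by
  refine contDiff_infty.2 fun n => ?_
  induction n generalizing φ with
  | zero =>
    refine contDiff_zero.2 (continuous_iff_continuousAt.2 fun t => ?_)
    exact (hasDerivAt_conv₀ (contDiff_infty.1 hφ 1) hψ.continuous t).continuousAt
  | succ n ih =>
    rw [Nat.cast_succ, contDiff_succ_iff_deriv]
    refine ⟨fun t => (hasDerivAt_conv₀ (contDiff_infty.1 hφ 1) hψ.continuous t).differentiableAt,
      fun h => by simp at h, ?_⟩
    rw [deriv_conv₀ (contDiff_infty.1 hφ 1) hψ.continuous]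
    exact (contDiff_const.smul (contDiff_infty.1 hψ n)).add (ih (contDiff_infty_iff_deriv.1 hφ).2)

/-- Each differentiation moves onto `φ` and leaves the boundary term `φ 0 • ψ`; the sum collects
these terms, which do not vanish for general `φ`. -/
theorem iteratedDeriv_conv₀ {φ ψ : ℝ → ℂ} (hφ : ContDiff ℝ ∞ φ) (hψ : ContDiff ℝ ∞ ψ) (n : ℕ)
    (t : ℝ) : iteratedDeriv n (conv₀ φ ψ) t = conv₀ (iteratedDeriv n φ) ψ t +
      ∑ k ∈ Finset.range n, iteratedDeriv k φ 0 * iteratedDeriv (n - 1 - k) ψ t := by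
  induction n generalizing φ with
  | zero => simp
  | succ n ih =>
    have hφ' : ContDiff ℝ ∞ (deriv φ) := (contDiff_infty_iff_deriv.1 hφ).2
    have hc := contDiff_conv₀ hφ' hψ
    rw [iteratedDeriv_succ', deriv_conv₀ (contDiff_infty.1 hφ 1) hψ.continuous,
      iteratedDeriv_add (f := φ 0 • ψ)
        ((contDiff_const.smul (contDiff_infty.1 hψ n)).contDiffAt)
        ((contDiff_infty.1 hc n).contDiffAt),
      iteratedDeriv_const_smul ((contDiff_infty.1 hψ n).contDiffAt), ih hφ',
      Finset.sum_range_succ', ← iteratedDeriv_succ']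
    simp only [← iteratedDeriv_succ', iteratedDeriv_zero, smul_eq_mul, Nat.add_sub_cancel,
      Nat.sub_zero, Nat.sub_sub, Nat.add_comm 1]
    ring

theorem conv₀_eq_zero_of_lt {φ ψ : ℝ → ℂ} {R : ℝ} (hφ : ∀ t, R < |t| → φ t = 0)
    (hψ : ∀ t, R < |t| → ψ t = 0) {t : ℝ} (ht : 2 * R < |t|) : conv₀ φ ψ t = 0 := by
  refine intervalIntegral.integral_zero_ae (Eventually.of_forall fun s hs => ?_)
  by_cases h : R < |s|
  · rw [hψ s h, mul_zero]
  · rw [hφ (t - s) ?_, zero_mul]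
    have := abs_sub_abs_le_abs_sub t s
    linarith

theorem exists_radius {φ : ℝ → ℂ} (hφ : HasCompactSupport φ) :
    ∃ R > 0, ∀ t, R < |t| → φ t = 0 := by
  obtain ⟨R, hR, h⟩ := hφ.isCompact.isBounded.subset_ball_lt 0 0
  refine ⟨R, hR, fun t ht => by_contra fun hne => ?_⟩
  have := h (subset_tsupport _ hne)
  rw [Metric.mem_ball, dist_zero_right, Real.norm_eq_abs] at this
  linarith

theorem hasCompactSupport_of_radius {φ : ℝ → ℂ} {R : ℝ} (h : ∀ t, R < |t| → φ t = 0) :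
    HasCompactSupport φ := by
  refine HasCompactSupport.intro (isCompact_closedBall (0 : ℝ) R) fun t ht => h t ?_
  simpa [Metric.mem_closedBall, Real.dist_eq] using ht

theorem hasCompactSupport_conv₀ {φ ψ : ℝ → ℂ} (hφ : HasCompactSupport φ)
    (hψ : HasCompactSupport ψ) : HasCompactSupport (conv₀ φ ψ) := by
  obtain ⟨R, hR, h⟩ := exists_radius hφ
  obtain ⟨S, hS, k⟩ := exists_radius hψ
  refine hasCompactSupport_of_radius (R := 2 * max R S) fun t ht =>
    conv₀_eq_zero_of_lt (fun t ht => h t ((le_max_left _ _).trans_lt ht))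
      (fun t ht => k t ((le_max_right _ _).trans_lt ht)) ht

theorem conv₀_eq_zero_of_neg {φ ψ : ℝ → ℂ} (hψ : ∀ t < 0, ψ t = 0) {t : ℝ} (ht : t < 0) :
    conv₀ φ ψ t = 0 := by
  refine intervalIntegral.integral_zero_ae ?_
  -- The interval is `(t, 0]`, and nothing is assumed about `ψ 0`; the endpoint is a null set.
  have : ∀ᵐ s : ℝ, s ≠ 0 := by simp [ae_iff, measure_singleton]
  filter_upwards [this] with s hs0 hs
  rw [uIoc_of_ge ht.le] at hs
  rw [hψ s (lt_of_le_of_ne hs.2 hs0), mul_zero]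

/-- This transfers facts about ordinary convolution to `conv₀`. The outer `plus` matters because
`conv₀ φ ψ` need not vanish at negative times. -/
theorem conv_plus_plus (φ ψ : ℝ → ℂ) : conv (plus φ) (plus ψ) = plus (conv₀ φ ψ) := by
  funext t
  by_cases ht : 0 ≤ t
  · have h : (fun s => plus φ (t - s) * plus ψ s) = (Icc 0 t).indicator
        fun s => φ (t - s) * ψ s := by
      funext s
      by_cases h1 : 0 ≤ s <;> by_cases h2 : s ≤ t <;> simp [plus, indicator, h1, h2]
    rw [conv, h, integral_indicator measurableSet_Icc, plus,
      indicator_of_mem (show t ∈ Ici 0 from ht), conv₀, intervalIntegral.integral_of_le ht,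
      integral_Icc_eq_integral_Ioc]
  · have h : ∀ s, plus φ (t - s) * plus ψ s = 0 := by
      intro s
      by_cases h1 : 0 ≤ s
      · have : ¬ s ≤ t := by linarith
        simp [plus, indicator, this]
      · simp [plus, indicator, h1]
    simp only [conv, h, integral_zero]
    simp [plus, ht]

theorem plus_eq_self {η : ℝ → ℂ} (hη : ∀ t < 0, η t = 0) : plus η = η := by
  funext t
  by_cases ht : 0 ≤ t
  · simp [plus, ht]
  · simp [plus, ht, hη t (not_le.1 ht)]

theorem conv_plus_of_nonneg {φ η : ℝ → ℂ} (hη : ∀ t < 0, η t = 0) :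
    conv (plus φ) η = conv₀ φ η := by
  conv_lhs => rw [← plus_eq_self hη]
  rw [conv_plus_plus, plus_eq_self fun t ht => conv₀_eq_zero_of_neg hη ht]

theorem conv_eq_conv₀ {φ η : ℝ → ℂ} (hφ : ∀ t < 0, φ t = 0) (hη : ∀ t < 0, η t = 0) :
    conv φ η = conv₀ φ η := by
  conv_lhs => rw [← plus_eq_self hφ]
  exact conv_plus_of_nonneg hη

theorem integrable_plus {φ : ℝ → ℂ} (hφ : Continuous φ) (h : HasCompactSupport φ) :
    Integrable (plus φ) :=
  (hφ.integrable_of_hasCompactSupport h).indicator measurableSet_Ici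

/-! ### Associativity of convolution and a Fubini identity -/

theorem conv_eq_convolution (f g : ℝ → ℂ) :
    conv f g = convolution f g (ContinuousLinearMap.mul ℂ ℂ) volume := by
  funext t
  rw [convolution_mul_swap]
  rfl

/-- The third factor need only be bounded and measurable, so it may be a truncated continuous
function; boundedness also makes the identity hold at every point. -/
theorem conv_assoc {f g k : ℝ → ℂ} (hf : Integrable f) (hg : Integrable g)
    (hk : AEStronglyMeasurable k) {B : ℝ} (hB : ∀ t, ‖k t‖ ≤ B) :
    conv (conv f g) k = conv f (conv g k) := by
  funext x₀
  simp only [conv_eq_convolution]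
  refine convolution_assoc' _ _ _ _ (fun x y z => by simp [mul_assoc]) ?_ ?_ ?_
  · exact hf.ae_convolution_exists _ hg
  · refine Eventually.of_forall fun x => ?_
    refine Integrable.mul_bdd hg ?_ (Eventually.of_forall fun t => hB _)
    exact hk.comp_quasiMeasurePreserving (quasiMeasurePreserving_sub_left volume x)
  · have h1 := hf.convolution_integrand (ContinuousLinearMap.mul ℂ ℂ) hg
    have h2 : AEStronglyMeasurable (fun z : ℝ × ℝ => k (x₀ - z.1)) (volume.prod volume) :=
      (hk.comp_quasiMeasurePreserving (quasiMeasurePreserving_sub_left volume x₀)).comp_fst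
    refine (h1.mul_bdd h2 (Eventually.of_forall fun z => hB _)).congr
      (Eventually.of_forall fun z => ?_)
    simp [mul_assoc, Function.uncurry]

theorem conv₀_assoc {φ ψ η : ℝ → ℂ} (hφ : Continuous φ) (hφ' : HasCompactSupport φ)
    (hψ : Continuous ψ) (hψ' : HasCompactSupport ψ) (hη : Continuous η)
    (hη' : HasCompactSupport η) (hη₀ : ∀ t < 0, η t = 0) :
    conv₀ (conv₀ φ ψ) η = conv₀ φ (conv₀ ψ η) := by
  obtain ⟨B, hB⟩ := hη.bounded_above_of_compact_support hη'
  rw [← conv_plus_of_nonneg hη₀, ← conv_plus_of_nonneg (η := conv₀ ψ η)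
    (fun t ht => conv₀_eq_zero_of_neg hη₀ ht), ← conv_plus_of_nonneg hη₀, ← conv_plus_plus]
  exact conv_assoc (integrable_plus hφ hφ') (integrable_plus hψ hψ') hη.aestronglyMeasurable hB

/-- Fubini's theorem in the form: integrating `φ *₀ ζ` against `b` is integrating `φ` against
`s ↦ ∫ ζ(r) b(s + r) dr`. -/
theorem integral_conv₀_mul {φ ζ b : ℝ → ℂ} (hφ : Continuous φ) (hφ' : HasCompactSupport φ)
    (hζ : Continuous ζ) (hζ' : HasCompactSupport ζ) (hb : Continuous b) :
    ∫ t in Ici (0 : ℝ), conv₀ φ ζ t * b t =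
      ∫ s in Ici (0 : ℝ), φ s * ∫ r in Ici (0 : ℝ), ζ r * b (s + r) := by
  obtain ⟨R₁, hR₁, h₁⟩ := exists_radius hφ'
  obtain ⟨R₂, hR₂, h₂⟩ := exists_radius hζ'
  set R := max R₁ R₂
  have hR : 0 ≤ R := hR₁.le.trans (le_max_left _ _)
  have k₁ : ∀ t, R < |t| → φ t = 0 := fun t ht => h₁ t ((le_max_left _ _).trans_lt ht)
  have k₂ : ∀ t, R < |t| → ζ t = 0 := fun t ht => h₂ t ((le_max_right _ _).trans_lt ht)
  have hb' : Continuous fun t => b (-t) := by fun_prop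
  obtain ⟨B, hB⟩ := (isCompact_Icc (a := -(2 * R)) (b := 0)).exists_bound_of_continuousOn
    hb'.continuousOn
  have hB0 : 0 ≤ B := (norm_nonneg _).trans (hB 0 ⟨by linarith, le_rfl⟩)
  -- The identity is associativity evaluated at `0`, with `b` reflected as third factor. Only
  -- arguments of `b` in `[0, 2R]` matter, so cutting there makes the factor bounded at no cost.
  let k : ℝ → ℂ := (Icc (-(2 * R)) 0).indicator fun t => b (-t)
  have hk : ∀ t, ‖k t‖ ≤ B := by
    intro t
    by_cases ht : t ∈ Icc (-(2 * R)) 0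
    · simpa [k, ht] using hB t ht
    · simpa [k, ht] using hB0
  have key := congrFun (conv_assoc (integrable_plus hφ hφ') (integrable_plus hζ hζ')
    (hb'.aestronglyMeasurable.indicator measurableSet_Icc) hk) 0
  have hL : conv (conv (plus φ) (plus ζ)) k 0 = ∫ t in Ici (0 : ℝ), conv₀ φ ζ t * b t := by
    rw [conv_plus_plus, conv, ← integral_neg_eq_self, ← integral_indicator measurableSet_Ici]
    congr 1
    funext t
    by_cases ht : 0 ≤ t
    · by_cases h2 : t ≤ 2 * R
      · simp [k, plus, ht, h2]
      · have : conv₀ φ ζ t = 0 := conv₀_eq_zero_of_lt k₁ k₂ (by rw [abs_of_nonneg ht]; linarith)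
        simp [plus, ht, this]
    · simp [plus, ht]
  have hM : ∀ s, 0 ≤ s → s ≤ R → conv (plus ζ) k (-s) = ∫ r in Ici (0 : ℝ), ζ r * b (s + r) := by
    intro s hs hsR
    rw [conv_eq_convolution, convolution_def, ← integral_indicator measurableSet_Ici]
    congr 1
    funext t
    by_cases ht : 0 ≤ t
    · by_cases h2 : t ≤ R
      · have h3 : -s ≤ t := by linarith
        have h4 : s + t ≤ 2 * R := by linarith
        have h5 : -s - t ∈ Icc (-(2 * R)) 0 := ⟨by linarith, by linarith⟩
        have h6 : -(-s - t) = s + t := by ring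
        simp only [k, indicator_of_mem h5, h6]
        simp [plus, ht]
      · have : ζ t = 0 := k₂ t (by rw [abs_of_nonneg ht]; linarith)
        simp [plus, ht, this]
    · simp [plus, ht]
  have hRt : conv (plus φ) (conv (plus ζ) k) 0 =
      ∫ s in Ici (0 : ℝ), φ s * ∫ r in Ici (0 : ℝ), ζ r * b (s + r) := by
    rw [conv, ← integral_neg_eq_self, ← integral_indicator measurableSet_Ici]
    congr 1
    funext s
    by_cases hs : 0 ≤ s
    · by_cases h2 : s ≤ R
      · rw [hM s hs h2]
        simp [plus, hs]
      · have : φ s = 0 := k₁ s (by rw [abs_of_nonneg hs]; linarith)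
        simp [plus, hs, this]
    · simp [plus, hs]
  rw [← hL, key, hRt]


/-! ### Uniqueness and approximation -/

/-- By Weierstrass, some polynomial `p` is within `ε` of `g` on its support, and `∫ g² = ∫ g (g - p)
≤ ε ∫ |g|`. -/
theorem eq_zero_of_forall_integral_pow_mul_eq_zero_real {g : ℝ → ℝ} (hg : Continuous g)
    (hc : HasCompactSupport g) (h : ∀ n : ℕ, ∫ t, t ^ n * g t = 0) : g = 0 := by
  have hpoly : ∀ p : Polynomial ℝ, ∫ t, p.eval t * g t = 0 := by
    intro p
    simp only [Polynomial.eval_eq_sum_range, Finset.sum_mul, mul_assoc]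
    rw [integral_finsetSum]
    · simp [integral_const_mul, h]
    · intro i _
      exact Continuous.integrable_of_hasCompactSupport (by fun_prop)
        ((hc.mul_left (f := fun t => t ^ i)).mul_left (f := fun _ => p.coeff i))
  obtain ⟨R, hR⟩ := hc.isCompact.isBounded.subset_closedBall 0
  rw [Real.closedBall_eq_Icc] at hR
  have hgi : Integrable g := hg.integrable_of_hasCompactSupport hc
  have hg2 : Integrable fun t => g t * g t :=
    Continuous.integrable_of_hasCompactSupport (by fun_prop) (hc.mul_left (f := g))
  have hle : ∀ ε > 0, ∫ t, g t * g t ≤ ε * ∫ t, ‖g t‖ := by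
    intro ε hε
    obtain ⟨p, hp⟩ := exists_polynomial_near_of_continuousOn (0 - R) (0 + R) g hg.continuousOn ε hε
    have hpi : Integrable fun t => p.eval t * g t :=
      Continuous.integrable_of_hasCompactSupport (by fun_prop)
        (hc.mul_left (f := fun t => p.eval t))
    have e : ∫ t, g t * g t = ∫ t, (g t * g t - p.eval t * g t) := by
      rw [integral_sub hg2 hpi, hpoly, sub_zero]
    rw [e, ← integral_const_mul]
    refine integral_mono (hg2.sub hpi) (hgi.norm.const_mul ε) fun t => ?_
    by_cases ht : g t = 0
    · simp [ht]
    · have := hp t (hR (subset_tsupport _ ht))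
      rw [abs_sub_comm] at this
      calc g t * g t - p.eval t * g t ≤ |(g t - p.eval t) * g t| := by
            rw [← sub_mul]; exact le_abs_self _
        _ ≤ ε * ‖g t‖ := by
            rw [abs_mul, Real.norm_eq_abs]
            gcongr
  have h0 : ∫ t, g t * g t = 0 := by
    refine le_antisymm (le_of_forall_pos_le_add fun ε hε => ?_)
      (integral_nonneg fun t => mul_self_nonneg _)
    have hn : 0 ≤ ∫ t, ‖g t‖ := integral_nonneg fun t => norm_nonneg _
    refine (hle (ε / (1 + ∫ t, ‖g t‖)) (by positivity)).trans ?_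
    rw [zero_add, div_mul_eq_mul_div, div_le_iff₀ (by positivity)]
    nlinarith
  have h1 := (integral_eq_zero_iff_of_nonneg (fun t => mul_self_nonneg (g t)) hg2).1 h0
  have h2 := (Continuous.ae_eq_iff_eq volume (by fun_prop) continuous_const).1 h1
  funext t
  exact mul_self_eq_zero.1 (congrFun h2 t)

/-- A continuous function with compact support whose moments all vanish is zero. -/
theorem eq_zero_of_forall_integral_pow_mul_eq_zero {g : ℝ → ℂ} (hg : Continuous g)
    (hc : HasCompactSupport g) (h : ∀ n : ℕ, ∫ t : ℝ, (t : ℂ) ^ n * g t = 0) : g = 0 := by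
  have hi : ∀ n : ℕ, Integrable fun t : ℝ => (t : ℂ) ^ n * g t := fun n =>
    Continuous.integrable_of_hasCompactSupport (by fun_prop)
      (hc.mul_left (f := fun t : ℝ => (t : ℂ) ^ n))
  have hre : (fun t => (g t).re) = 0 := by
    refine eq_zero_of_forall_integral_pow_mul_eq_zero_real (by fun_prop)
      (hc.comp_left Complex.zero_re) fun n => ?_
    have := integral_re (𝕜 := ℂ) (hi n)
    rw [h n] at this
    simpa [← Complex.ofReal_pow] using this
  have him : (fun t => (g t).im) = 0 := by
    refine eq_zero_of_forall_integral_pow_mul_eq_zero_real (by fun_prop)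
      (hc.comp_left Complex.zero_im) fun n => ?_
    have := integral_im (𝕜 := ℂ) (hi n)
    rw [h n] at this
    simpa [← Complex.ofReal_pow] using this
  funext t
  exact Complex.ext (congrFun hre t) (congrFun him t)

/-- The Riemann sum of `φ W` over `[0, R]` which integrates `φ` exactly over each cell. -/
noncomputable def riemannWeight (φ : ℝ → ℂ) (R : ℝ) (n i : ℕ) : ℂ :=
  ∫ s in (R * i / (n + 1))..(R * (i + 1) / (n + 1)), φ s

/-- As `φ` is integrated exactly on each cell, only the oscillation of `W` contributes. The explicit
bound can be applied to all derivatives of a test function at once. -/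
theorem norm_riemannSum_sub_le {φ W : ℝ → ℂ} (hφ : Continuous φ) (hW : Continuous W) {R : ℝ}
    (hR : 0 ≤ R) (n : ℕ) {η : ℝ}
    (hη : ∀ s ∈ Icc 0 R, ∀ s' ∈ Icc 0 R, |s - s'| ≤ R / (n + 1) → ‖W s - W s'‖ ≤ η) :
    ‖∑ i ∈ Finset.range (n + 1), riemannWeight φ R n i * W (R * i / (n + 1)) -
      ∫ s in (0 : ℝ)..R, φ s * W s‖ ≤ η * ∫ s in (0 : ℝ)..R, ‖φ s‖ := by
  have hn : (0 : ℝ) < n + 1 := by positivity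
  let a : ℕ → ℝ := fun i => R * i / (n + 1)
  have ha : ∀ i, a (i + 1) = R * (i + 1) / (n + 1) := fun i => by simp [a]
  have hmono : ∀ i, a i ≤ a (i + 1) := fun i => by
    rw [ha]; simp only [a]; gcongr; linarith
  have ha0 : a 0 = 0 := by simp [a]
  have han : a (n + 1) = R := by rw [ha]; field_simp
  have e1 := intervalIntegral.sum_integral_adjacent_intervals (μ := volume) (a := a) (n := n + 1)
    (f := fun s => φ s * W s)
    fun k _ => Continuous.intervalIntegrable (by fun_prop) _ _
  have e2 := intervalIntegral.sum_integral_adjacent_intervals (μ := volume) (a := a) (n := n + 1)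
    (f := fun s => ‖φ s‖)
    fun k _ => Continuous.intervalIntegrable (by fun_prop) _ _
  rw [ha0, han] at e1 e2
  rw [← e1, ← e2, ← Finset.sum_sub_distrib, Finset.mul_sum]
  refine norm_sum_le_of_le _ fun i hi => ?_
  have hi' : i + 1 ≤ n + 1 := Finset.mem_range.1 hi
  have hi0 : 0 ≤ a i := by simp only [a]; positivity
  have hin : a (i + 1) ≤ R := by
    rw [ha, div_le_iff₀ hn]
    have : (i : ℝ) + 1 ≤ n + 1 := by exact_mod_cast hi'
    gcongr
  rw [riemannWeight, ← ha, ← intervalIntegral.integral_mul_const,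
    ← intervalIntegral.integral_sub, ← intervalIntegral.integral_const_mul]
  · refine intervalIntegral.norm_integral_le_of_norm_le (hmono i)
      (Eventually.of_forall fun s hs => ?_) (Continuous.intervalIntegrable (by fun_prop) _ _)
    rw [← mul_sub, norm_mul, mul_comm]
    gcongr
    refine hη _ ⟨hi0, (hmono i).trans hin⟩ _ ⟨hi0.trans hs.1.le, hs.2.trans hin⟩ ?_
    have h3 : a (i + 1) - a i = R / (n + 1) := by rw [ha]; simp only [a]; ring
    have h1 := hs.1.le
    have h2 := hs.2
    change a i ≤ s at h1
    change |a i - s| ≤ _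
    rw [abs_sub_comm, abs_of_nonneg (by linarith)]
    linarith
  · exact Continuous.intervalIntegrable (by fun_prop) _ _
  · exact Continuous.intervalIntegrable (by fun_prop) _ _

theorem tendsto_riemannSum {φ W : ℝ → ℂ} (hφ : Continuous φ) (hW : Continuous W) {R : ℝ}
    (hR : 0 ≤ R) :
    Tendsto (fun n : ℕ => ∑ i ∈ Finset.range (n + 1), riemannWeight φ R n i * W (R * i / (n + 1)))
      atTop (𝓝 (∫ s in (0 : ℝ)..R, φ s * W s)) := by
  rw [Metric.tendsto_atTop]
  intro ε hε
  have hI : 0 ≤ ∫ s in (0 : ℝ)..R, ‖φ s‖ :=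
    intervalIntegral.integral_nonneg hR fun _ _ => norm_nonneg _
  have huc := (isCompact_Icc (a := (0 : ℝ)) (b := R)).uniformContinuousOn_of_continuous
    hW.continuousOn
  set η := ε / (1 + ∫ s in (0 : ℝ)..R, ‖φ s‖)
  have hηp : 0 < η := by positivity
  obtain ⟨δ, hδ, h⟩ := Metric.uniformContinuousOn_iff.1 huc η hηp
  obtain ⟨N, hN⟩ := exists_nat_gt (R / δ)
  refine ⟨N, fun n hn => ?_⟩
  rw [dist_eq_norm]
  refine (norm_riemannSum_sub_le hφ hW hR n (η := η) fun s hs s' hs' hss => ?_).trans_lt ?_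
  · rw [← dist_eq_norm]
    refine (h s hs s' hs' ?_).le
    rw [Real.dist_eq]
    refine hss.trans_lt ?_
    rw [div_lt_iff₀ (by positivity)]
    rw [div_lt_iff₀ hδ] at hN
    have : (N : ℝ) ≤ n := by exact_mod_cast hn
    nlinarith
  · simp only [η]
    rw [div_mul_eq_mul_div, div_lt_iff₀ (by positivity)]
    nlinarith


/-! ### Spaces of test functions -/

/-- The properties of a space of test functions on `ℝ` which the theory of `C`-distribution
semigroups uses. They are shared by `𝒟`, `𝒟^{(M_p)}` and `𝒟^{{M_p}}`. -/
class TestSpace (𝒯 : Type*) [AddCommGroup 𝒯] [Module ℂ 𝒯] [TopologicalSpace 𝒯]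
    [FunLike 𝒯 ℝ ℂ] : Prop where
  coe_add (φ ψ : 𝒯) : ⇑(φ + ψ) = ⇑φ + ⇑ψ
  coe_smul (c : ℂ) (φ : 𝒯) : ⇑(c • φ) = c • ⇑φ
  contDiff (φ : 𝒯) : ContDiff ℝ ∞ φ
  hasCompactSupport (φ : 𝒯) : HasCompactSupport φ
  exists_translate (φ : 𝒯) (a : ℝ) : ∃ χ : 𝒯, ⇑χ = fun t => φ (t - a)
  exists_id_mul (φ : 𝒯) : ∃ χ : 𝒯, ⇑χ = fun t : ℝ => (t : ℂ) * φ t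
  exists_conv₀ (φ ψ : 𝒯) : ∃ χ : 𝒯, ⇑χ = conv₀ φ ψ
  -- The estimate is available for every bound `S` on the derivatives of `ζ`, so each space may
  -- insert its own growth rate. The shift `p + 1` is the derivative lost in the mean value theorem.
  tendsto_of_norm_iteratedDeriv_sub_le (χ : ℕ → 𝒯) (χ₀ ζ : 𝒯) (K : Set ℝ) (hK : IsCompact K)
    (hχ : ∀ n, tsupport (χ n) ⊆ K) (hχ₀ : tsupport χ₀ ⊆ K) (ε : ℕ → ℝ)
    (hε : Tendsto ε atTop (𝓝 0))
    (h : ∀ S : ℕ → ℝ, (∀ p t, ‖iteratedDeriv p ζ t‖ ≤ S p) → ∀ n p t,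
      ‖iteratedDeriv p (χ n) t - iteratedDeriv p χ₀ t‖ ≤ ε n * S (p + 1)) :
    Tendsto χ atTop (𝓝 χ₀)

theorem mem_testNonneg_iff {𝒯 : Type*} [FunLike 𝒯 ℝ ℂ] {φ : 𝒯} :
    φ ∈ testNonneg 𝒯 ↔ ∀ t < 0, φ t = 0 := by
  refine ⟨fun h t ht => image_eq_zero_of_notMem_tsupport fun hmem => ?_, fun h => ?_⟩
  · exact absurd (h hmem) (not_le.2 ht)
  · refine closure_minimal (fun t ht => ?_) isClosed_Ici
    by_contra hlt
    exact ht (h t (not_le.1 hlt))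

theorem hasCompactSupport_iteratedDeriv {φ : ℝ → ℂ} (h : HasCompactSupport φ) (p : ℕ) :
    HasCompactSupport (iteratedDeriv p φ) := by
  induction p with
  | zero => rwa [iteratedDeriv_zero]
  | succ p ih => rw [iteratedDeriv_succ]; exact ih.deriv

namespace TestSpace

variable {𝒯 : Type*} [AddCommGroup 𝒯] [Module ℂ 𝒯] [TopologicalSpace 𝒯] [FunLike 𝒯 ℝ ℂ]
  [TestSpace 𝒯]

theorem continuous (φ : 𝒯) : Continuous φ := (contDiff φ).continuous

theorem coe_sum {ι : Type*} (s : Finset ι) (f : ι → 𝒯) (t : ℝ) :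
    (∑ i ∈ s, f i) t = ∑ i ∈ s, f i t :=
  map_sum (AddMonoidHom.mk' (fun φ : 𝒯 => φ t) fun φ ψ => by simp [coe_add]) f s

theorem coe_zero : ⇑(0 : 𝒯) = 0 := by
  have := coe_smul (0 : ℂ) (0 : 𝒯)
  rwa [zero_smul, zero_smul] at this

theorem exists_pow_mul {φ : 𝒯} (hφ : φ ∈ testNonneg 𝒯) (n : ℕ) :
    ∃ χ ∈ testNonneg 𝒯, ∀ t, χ t = (t : ℂ) ^ n * φ t := by
  induction n with
  | zero => exact ⟨φ, hφ, by simp⟩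
  | succ n ih =>
    obtain ⟨χ, h0, h⟩ := ih
    obtain ⟨χ', h'⟩ := exists_id_mul χ
    refine ⟨χ', mem_testNonneg_iff.2 fun t ht => ?_, fun t => ?_⟩
    · simp [h', mem_testNonneg_iff.1 h0 t ht]
    · simp only [h', h, pow_succ']
      ring

/-- If there is a nonzero test function supported in `[0,∞)`, then these test functions separate
the continuous functions on `[0,∞)`. -/
theorem eq_zero_of_forall_integral_mul_eq_zero {φ₀ : 𝒯} (h₀ : φ₀ ∈ testNonneg 𝒯)
    (hne : ⇑φ₀ ≠ 0) {f : ℝ → ℂ} (hf : Continuous f)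
    (h : ∀ φ ∈ testNonneg 𝒯, ∫ t in Ici (0 : ℝ), φ t * f t = 0) : ∀ t, 0 ≤ t → f t = 0 := by
  have hpos : EqOn f 0 (Ioi 0) := by
    intro s hs
    obtain ⟨b₀, hb₀⟩ := Function.ne_iff.1 hne
    have hbdd : BddBelow (Function.support φ₀) :=
      ⟨0, fun t ht => not_lt.1 fun hlt => ht (mem_testNonneg_iff.1 h₀ t hlt)⟩
    -- A point `b` with `φ₀ b ≠ 0` less than `s` above the infimum of the support: translation by `s
    -- - b` moves `b` to `s` and keeps the support in `[0,∞)`.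
    obtain ⟨b, hb, hbs⟩ := exists_lt_of_csInf_lt (⟨b₀, hb₀⟩ : (Function.support φ₀).Nonempty)
      (lt_add_of_pos_right (sInf (Function.support φ₀)) hs)
    obtain ⟨φ, hφ⟩ := exists_translate φ₀ (s - b)
    have hφ0 : φ ∈ testNonneg 𝒯 := by
      refine mem_testNonneg_iff.2 fun t ht => ?_
      by_contra hne'
      rw [hφ] at hne'
      have := csInf_le hbdd hne'
      linarith
    -- Since `t ^ n * φ` is again a test function, every moment of `φ f` vanishes; no bump functions
    -- are needed.
    have hg : (fun t => φ t * f t) = 0 := by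
      refine eq_zero_of_forall_integral_pow_mul_eq_zero ((continuous φ).mul hf)
        ((hasCompactSupport φ).mul_right) fun n => ?_
      obtain ⟨χ, hχ0, hχ⟩ := exists_pow_mul hφ0 n
      rw [← h χ hχ0, ← integral_indicator measurableSet_Ici]
      congr 1
      funext t
      by_cases ht : 0 ≤ t
      · simp [ht, hχ, mul_assoc]
      · simp [ht, mem_testNonneg_iff.1 hφ0 t (not_le.1 ht)]
    have hs' := congrFun hg s
    simp only [hφ, sub_sub_cancel, Pi.zero_apply, mul_eq_zero] at hs'
    exact hs'.resolve_left hb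
  have := hpos.closure hf continuous_const
  rw [closure_Ioi] at this
  exact fun t ht => this ht

end TestSpace

/-! ### Mean value bound and flatness at the origin -/

theorem norm_iteratedDeriv_sub_le {φ : ℝ → ℂ} (hφ : ContDiff ℝ ∞ φ) {p : ℕ} {B : ℝ}
    (hB : ∀ t, ‖iteratedDeriv (p + 1) φ t‖ ≤ B) (a b : ℝ) :
    ‖iteratedDeriv p φ a - iteratedDeriv p φ b‖ ≤ B * |a - b| := by
  refine Convex.norm_image_sub_le_of_norm_deriv_le (s := univ) (fun t _ => ?_) (fun t _ => ?_)
    convex_univ (mem_univ _) (mem_univ _)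
  · exact (hφ.differentiable_iteratedDeriv p (by exact_mod_cast WithTop.coe_lt_top _)) t
  · rw [← iteratedDeriv_succ]
    exact hB t

theorem iteratedDeriv_eq_zero_of_nonpos {ζ : ℝ → ℂ} (hζ : ContDiff ℝ ∞ ζ)
    (h : ∀ t < 0, ζ t = 0) (p : ℕ) : ∀ t ≤ 0, iteratedDeriv p ζ t = 0 := by
  have h1 : EqOn (iteratedDeriv p ζ) 0 (Iio 0) := by
    have h2 : EqOn ζ 0 (Iio 0) := fun t ht => h t ht
    intro t ht
    rw [h2.iteratedDeriv_of_isOpen isOpen_Iio p ht]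
    exact iteratedDeriv_const_zero
  have := h1.closure (hζ.continuous_iteratedDeriv p (by exact_mod_cast le_top)) continuous_const
  rw [closure_Iio] at this
  exact fun t ht => this ht

theorem setIntegral_Ici_eq_intervalIntegral {f : ℝ → ℂ} {R : ℝ} (hR : 0 ≤ R)
    (h : ∀ t, R < |t| → f t = 0) : ∫ t in Ici (0 : ℝ), f t = ∫ t in (0 : ℝ)..R, f t := by
  rw [intervalIntegral.integral_of_le hR, ← integral_Icc_eq_integral_Ioc,
    ← integral_indicator measurableSet_Ici, ← integral_indicator measurableSet_Icc]
  congr 1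
  funext t
  by_cases ht : 0 ≤ t
  · by_cases h2 : t ≤ R
    · simp [ht, h2]
    · simp [ht, h2, h t (by rw [abs_of_nonneg ht]; linarith)]
  · simp [ht]

/-- The range of integration no longer depends on `t`, so one Riemann partition serves all `t`. -/
theorem conv₀_eq_intervalIntegral {φ g : ℝ → ℂ} (hg : ∀ t < 0, g t = 0) {R : ℝ} (hR : 0 ≤ R)
    (hφ : ∀ t, R < |t| → φ t = 0) (t : ℝ) :
    conv₀ φ g t = ∫ s in (0 : ℝ)..R, φ s * g (t - s) := by
  have h1 : plus (conv₀ g φ) = conv₀ φ g := by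
    rw [conv₀_comm g φ, plus_eq_self fun t ht => conv₀_eq_zero_of_neg hg ht]
  rw [← h1, ← conv_plus_plus, plus_eq_self hg,
    ← setIntegral_Ici_eq_intervalIntegral hR fun s hs => by rw [hφ s hs, zero_mul],
    ← integral_indicator measurableSet_Ici]
  simp only [conv]
  congr 1
  funext s
  by_cases hs : 0 ≤ s
  · simp [plus, hs, mul_comm]
  · simp [plus, hs]

/-- All derivatives of `ζ` vanish at `0`, which kills the boundary terms when they are put on `ζ`.
-/
theorem iteratedDeriv_conv₀_of_nonneg {φ ζ : ℝ → ℂ} (hφ : ContDiff ℝ ∞ φ) (hζ : ContDiff ℝ ∞ ζ)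
    (hζ₀ : ∀ t < 0, ζ t = 0) (p : ℕ) :
    iteratedDeriv p (conv₀ φ ζ) = conv₀ φ (iteratedDeriv p ζ) := by
  funext t
  rw [conv₀_comm φ ζ, iteratedDeriv_conv₀ hζ hφ, conv₀_comm φ, Finset.sum_eq_zero, add_zero]
  intro k _
  rw [iteratedDeriv_eq_zero_of_nonpos hζ hζ₀ k 0 le_rfl, zero_mul]

namespace TestSpace

variable {𝒯 : Type*} [AddCommGroup 𝒯] [Module ℂ 𝒯] [TopologicalSpace 𝒯] [FunLike 𝒯 ℝ ℂ]
  [TestSpace 𝒯]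

theorem tsupport_subset_closedBall {φ : ℝ → ℂ} {R : ℝ} (h : ∀ t, R < |t| → φ t = 0) :
    tsupport φ ⊆ Metric.closedBall 0 R := by
  refine closure_minimal (fun t ht => ?_) Metric.isClosed_closedBall
  by_contra hlt
  refine ht (h t ?_)
  simpa [Real.dist_eq] using hlt

/-- Translation is continuous. -/
theorem continuous_translate {ζ : 𝒯} {τ : ℝ → 𝒯} (hτ : ∀ a, ⇑(τ a) = fun t => ζ (t - a)) :
    Continuous τ := by
  refine continuous_iff_seqContinuous.2 fun s a hs => ?_
  obtain ⟨R, hR, hζ⟩ := exists_radius (hasCompactSupport ζ)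
  -- A convergent sequence of shifts is bounded, so the translates share a compact support.
  obtain ⟨B, hB⟩ := (Metric.isBounded_range_of_tendsto s hs).exists_norm_le
  have hBa : ‖a‖ ≤ B := le_of_tendsto hs.norm <|
    (Eventually.of_forall fun n => hB _ (mem_range_self n))
  have hsupp : ∀ c, ‖c‖ ≤ B → tsupport (τ c) ⊆ Metric.closedBall 0 (R + B) := by
    intro c hc
    refine tsupport_subset_closedBall fun t ht => ?_
    rw [hτ]
    refine hζ _ ?_
    have := abs_sub_abs_le_abs_sub t c
    rw [Real.norm_eq_abs] at hc
    linarith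
  refine tendsto_of_norm_iteratedDeriv_sub_le _ _ ζ _ (isCompact_closedBall 0 (R + B))
    (fun n => hsupp _ (hB _ (mem_range_self n))) (hsupp a hBa) (fun n => |s n - a|) ?_ ?_
  · have := (hs.sub_const a).abs
    simpa using this
  · intro S hS n p t
    simp only [Function.comp_apply, hτ, iteratedDeriv_comp_sub_const]
    refine (norm_iteratedDeriv_sub_le (contDiff ζ) (hS (p + 1)) _ _).trans_eq ?_
    rw [mul_comm, ← abs_neg]
    congr 2
    ring

/-- `φ *₀ ζ` is the limit of Riemann sums of translates of `ζ`. -/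
theorem tendsto_sum_riemannWeight_smul {φ ζ χ : 𝒯} (hζ : ζ ∈ testNonneg 𝒯) (hχ : ⇑χ = conv₀ φ ζ)
    {τ : ℝ → 𝒯} (hτ : ∀ a, ⇑(τ a) = fun t => ζ (t - a)) {R : ℝ} (hR : 0 ≤ R)
    (hφR : ∀ t, R < |t| → φ t = 0) (hζR : ∀ t, R < |t| → ζ t = 0) :
    Tendsto (fun n : ℕ => ∑ i ∈ Finset.range (n + 1),
      riemannWeight φ R n i • τ (R * i / (n + 1))) atTop (𝓝 χ) := by
  have hζ0 := mem_testNonneg_iff.1 hζ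
  have hcoe : ∀ n : ℕ, ⇑(∑ i ∈ Finset.range (n + 1), riemannWeight φ R n i • τ (R * i / (n + 1))) =
      fun t => ∑ i ∈ Finset.range (n + 1), riemannWeight φ R n i * ζ (t - R * i / (n + 1)) := by
    intro n
    funext t
    rw [coe_sum]
    exact Finset.sum_congr rfl fun i _ => by rw [coe_smul, hτ]; rfl
  refine tendsto_of_norm_iteratedDeriv_sub_le _ _ ζ _ (isCompact_closedBall 0 (2 * R))
    (fun n => tsupport_subset_closedBall fun t ht => ?_)
    (tsupport_subset_closedBall fun t ht => ?_)
    (fun n => R / (n + 1) * ∫ s in (0 : ℝ)..R, ‖φ s‖) ?_ ?_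
  · rw [hcoe]
    refine Finset.sum_eq_zero fun i hi => ?_
    have hi' : (i : ℝ) ≤ n + 1 := by exact_mod_cast (Finset.mem_range.1 hi).le
    have h0 : 0 ≤ R * i / (n + 1) := by positivity
    have h1 : R * i / (n + 1) ≤ R := by
      rw [div_le_iff₀ (by positivity)]
      gcongr
    have := abs_sub_abs_le_abs_sub t (R * i / (n + 1))
    rw [abs_of_nonneg h0] at this
    rw [hζR _ (by linarith), mul_zero]
  · rw [hχ]
    exact conv₀_eq_zero_of_lt hφR hζR ht
  · have h1 : Tendsto (fun n : ℕ => R / ((n : ℝ) + 1)) atTop (𝓝 0) :=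
      tendsto_const_nhds.div_atTop (tendsto_atTop_add_const_right _ _ tendsto_natCast_atTop_atTop)
    simpa using h1.mul_const (∫ s in (0 : ℝ)..R, ‖φ s‖)
  · intro S hS n p t
    have hc : Continuous (iteratedDeriv p ζ) :=
      (contDiff ζ).continuous_iteratedDeriv p (by exact_mod_cast le_top)
    have h1 : iteratedDeriv p (∑ i ∈ Finset.range (n + 1),
        riemannWeight φ R n i • τ (R * i / (n + 1)) : 𝒯) t =
        ∑ i ∈ Finset.range (n + 1), riemannWeight φ R n i *
          (fun s => iteratedDeriv p ζ (t - s)) (R * i / (n + 1)) := by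
      have hd : ∀ a, ContDiffAt ℝ p (fun t => ζ (t - a)) t := fun a =>
        ((contDiff_infty.1 (contDiff ζ) p).comp (contDiff_id.sub contDiff_const)).contDiffAt
      rw [hcoe, iteratedDeriv_fun_sum fun i _ => contDiffAt_const.mul (hd _)]
      refine Finset.sum_congr rfl fun i _ => ?_
      rw [iteratedDeriv_const_mul _ (hd _), iteratedDeriv_comp_sub_const]
    rw [h1, hχ, iteratedDeriv_conv₀_of_nonneg (contDiff φ) (contDiff ζ) hζ0,
      conv₀_eq_intervalIntegral (fun t ht =>
        iteratedDeriv_eq_zero_of_nonpos (contDiff ζ) hζ0 p t ht.le) hR hφR]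
    refine (norm_riemannSum_sub_le (W := fun s => iteratedDeriv p ζ (t - s)) (continuous φ)
      (by fun_prop) hR n (η := S (p + 1) * (R / (n + 1))) fun s _ s' _ hss => ?_).trans_eq
        (by ring)
    refine (norm_iteratedDeriv_sub_le (contDiff ζ) (hS (p + 1)) _ _).trans ?_
    have : 0 ≤ S (p + 1) := (norm_nonneg _).trans (hS (p + 1) 0)
    rw [sub_sub_sub_cancel_left, abs_sub_comm]
    gcongr

end TestSpace

/-! ### `C`-semigroups over a space of test functions -/

section

open TestSpace

theorem Commutes.apply {𝒯 : Type*} [AddCommGroup 𝒯] [Module ℂ 𝒯] [TopologicalSpace 𝒯] {E : Type*}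
    [AddCommGroup E] [Module ℂ E] [UniformSpace E] [IsUniformAddGroup E] [ContinuousSMul ℂ E]
    {G : 𝒯 →L[ℂ] (E →L[ℂ] E)} {C : E →L[ℂ] E} (hC : Commutes G C) (φ : 𝒯)
    (x : E) : G φ (C x) = C (G φ x) :=
  DFunLike.congr_fun (hC φ) x

variable {𝒯 : Type*} [AddCommGroup 𝒯] [Module ℂ 𝒯] [TopologicalSpace 𝒯] [FunLike 𝒯 ℝ ℂ]
  {E : Type*} [AddCommGroup E] [Module ℂ E] [UniformSpace E] [IsUniformAddGroup E]
  [ContinuousSMul ℂ E]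

theorem CS2.eq_of_forall_apply_eq {G : 𝒯 →L[ℂ] (E →L[ℂ] E)} (h2 : CS2 G) {x y : E}
    (h : ∀ η ∈ testNonneg 𝒯, G η x = G η y) : x = y := by
  have : x - y ∈ kernel G := fun η hη => by rw [map_sub, h η hη, sub_self]
  rw [h2] at this
  exact sub_eq_zero.1 this

theorem CS1.apply {G : 𝒯 →L[ℂ] (E →L[ℂ] E)} {C : E →L[ℂ] E} (h : CS1 G C) {φ ψ χ : 𝒯}
    (hχ : ⇑χ = conv₀ φ ψ) (x : E) : G χ (C x) = G φ (G ψ x) := by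
  obtain ⟨χ', h1, h2⟩ := h φ ψ
  obtain rfl : χ' = χ := DFunLike.coe_injective (h1.trans hχ.symm)
  exact DFunLike.congr_fun h2 x

theorem D1.apply {G : 𝒯 →L[ℂ] (E →L[ℂ] E)} {C : E →L[ℂ] E} (h : D1 G C) {φ ψ χ : 𝒯}
    (hφ : φ ∈ testNonneg 𝒯) (hψ : ψ ∈ testNonneg 𝒯) (hχ : ⇑χ = conv₀ φ ψ) (x : E) :
    G χ (C x) = G φ (G ψ x) := by
  obtain ⟨χ', h1, h2⟩ := h φ hφ ψ hψ
  rw [conv_eq_conv₀ (mem_testNonneg_iff.1 hφ) (mem_testNonneg_iff.1 hψ)] at h1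
  obtain rfl : χ' = χ := DFunLike.coe_injective (h1.trans hχ.symm)
  exact DFunLike.congr_fun h2 x

theorem CS1.d1 {G : 𝒯 →L[ℂ] (E →L[ℂ] E)} {C : E →L[ℂ] E} (h : CS1 G C) : D1 G C := by
  intro φ hφ ψ hψ
  rw [conv_eq_conv₀ (mem_testNonneg_iff.1 hφ) (mem_testNonneg_iff.1 hψ)]
  exact h φ ψ

variable [TestSpace 𝒯]

theorem exists_testNonneg_conv₀ (ψ : 𝒯) {η : 𝒯} (hη : η ∈ testNonneg 𝒯) :
    ∃ χ ∈ testNonneg 𝒯, ⇑χ = conv₀ ψ η := by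
  obtain ⟨χ, hχ⟩ := exists_conv₀ ψ η
  refine ⟨χ, mem_testNonneg_iff.2 fun t ht => ?_, hχ⟩
  rw [hχ]
  exact conv₀_eq_zero_of_neg (mem_testNonneg_iff.1 hη) ht

theorem mem_opOf_plus_iff {G : 𝒯 →L[ℂ] (E →L[ℂ] E)} {ψ : 𝒯} {z : E × E} :
    z ∈ opOf G (plus ψ) ↔
      ∀ η ∈ testNonneg 𝒯, ∀ χ : 𝒯, ⇑χ = conv₀ ψ η → G χ z.1 = G η z.2 := by
  refine forall₂_congr fun η hη => ?_
  rw [conv_plus_of_nonneg (mem_testNonneg_iff.1 hη)]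
  refine ⟨fun ⟨χ, h1, h2⟩ χ' h => ?_, fun h => ?_⟩
  · rwa [DFunLike.coe_injective (h.trans h1.symm)]
  · obtain ⟨χ, hχ⟩ := exists_conv₀ ψ η
    exact ⟨χ, hχ, h χ hχ⟩

theorem CS1.d5 {G : 𝒯 →L[ℂ] (E →L[ℂ] E)} {C : E →L[ℂ] E} (h : CS1 G C) (h2 : CS2 G) :
    D5 G C := by
  intro ψ
  ext ⟨x, y⟩
  have key : ∀ η χ : 𝒯, ⇑χ = conv₀ ψ η → G χ (C x) = G η (G ψ x) := fun η χ hχ =>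
    h.apply (hχ.trans (conv₀_comm _ _)) x
  simp only [mem_ofPred_eq, mem_opOf_plus_iff]
  refine ⟨fun hxy => h2.eq_of_forall_apply_eq fun η hη => ?_, fun hy η hη χ hχ => ?_⟩
  · obtain ⟨χ, hχ⟩ := exists_conv₀ ψ η
    rw [← hxy η hη χ hχ, key η χ hχ]
  · rw [hy, key η χ hχ]

/-- To prove `𝒢(φ *₀ ψ) C = 𝒢(φ) 𝒢(ψ)` it suffices to do so for `φ` supported in `[0,∞)`. -/
theorem cs1_of_forall_testNonneg {G : 𝒯 →L[ℂ] (E →L[ℂ] E)} {C : E →L[ℂ] E} (hC : Commutes G C)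
    (h2 : CS2 G)
    (h : ∀ ψ : 𝒯, ∀ η ∈ testNonneg 𝒯, ∀ χ : 𝒯, ⇑χ = conv₀ ψ η → ∀ x, G χ (C x) = G η (G ψ x)) :
    CS1 G C := by
  intro φ ψ
  obtain ⟨χ, hχ⟩ := exists_conv₀ φ ψ
  refine ⟨χ, hχ, ContinuousLinearMap.ext fun x => h2.eq_of_forall_apply_eq fun η hη => ?_⟩
  obtain ⟨α, hα⟩ := exists_conv₀ χ η
  obtain ⟨β, hβ0, hβ⟩ := exists_testNonneg_conv₀ φ hη
  have hαβ : ⇑α = conv₀ ψ β := by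
    rw [hα, hβ, hχ, conv₀_comm φ ψ]
    exact conv₀_assoc (continuous ψ) (hasCompactSupport ψ) (continuous φ) (hasCompactSupport φ)
      (continuous η) (hasCompactSupport η) (mem_testNonneg_iff.1 hη)
  -- By commutation both sides become `C (G α (C x))`, where `α = (φ *₀ ψ) *₀ η = ψ *₀ (φ *₀ η)`.
  change G η (G χ (C x)) = G η (G φ (G ψ x))
  rw [← h χ η hη α hα, ← h φ η hη β hβ, hC.apply, hC.apply β, h ψ β hβ0 α hαβ]

theorem D5.cs1 {G : 𝒯 →L[ℂ] (E →L[ℂ] E)} {C : E →L[ℂ] E} (h5 : D5 G C) (hC : Commutes G C)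
    (h2 : CS2 G) : CS1 G C := by
  refine cs1_of_forall_testNonneg hC h2 fun ψ η hη χ hχ x => ?_
  have : (x, G ψ x) ∈ {z : E × E | (C z.1, z.2) ∈ opOf G (plus ψ)} := by
    rw [h5 ψ]
    rfl
  exact mem_opOf_plus_iff.1 this η hη χ hχ

theorem continuous_integral_mul_add {ζ b : ℝ → ℂ} (hζ : Continuous ζ) (hζ' : HasCompactSupport ζ)
    (hb : Continuous b) : Continuous fun s => ∫ r in Ici (0 : ℝ), ζ r * b (s + r) := by
  obtain ⟨R, hR, h⟩ := exists_radius hζ'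
  have : (fun s => ∫ r in Ici (0 : ℝ), ζ r * b (s + r)) =
      fun s => ∫ r in (0 : ℝ)..R, ζ r * b (s + r) :=
    funext fun s => setIntegral_Ici_eq_intervalIntegral hR.le fun r hr => by rw [h r hr, zero_mul]
  rw [this]
  exact intervalIntegral.continuous_parametric_intervalIntegral_of_continuous'
    (f := fun s r => ζ r * b (s + r)) (by fun_prop) _ _

theorem D4.apply_apply_of_mem_range [SeparatingDual ℂ E] {G : 𝒯 →L[ℂ] (E →L[ℂ] E)}
    {C : E →L[ℂ] E} (h4 : D4 G C) (hC : Commutes G C) (h1 : D1 G C) (h2 : CS2 G) {ψ ζ χ : 𝒯}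
    (hζ : ζ ∈ testNonneg 𝒯) (hχ : ⇑χ = conv₀ ψ ζ) {x : E} (hx : x ∈ range G) :
    G χ (C x) = G ζ (G ψ x) := by
  -- If the only test function supported in `[0,∞)` were zero, the kernel would be all of `E`, and
  -- `CS2` would make `E` trivial. This replaces a proof that such functions exist.
  by_cases hne : ∃ φ₀ ∈ testNonneg 𝒯, (⇑φ₀ : ℝ → ℂ) ≠ 0
  · obtain ⟨φ₀, hφ₀, hne⟩ := hne
    obtain ⟨u, hu, -, hG⟩ := h4 x hx
    by_contra hne'
    obtain ⟨l, hl⟩ := SeparatingDual.exists_separating_of_ne (R := ℂ) hne'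
    refine hl ?_
    -- Freezing `u` at `u 0` for negative times gives a continuous function on all of `ℝ`.
    have hmax : Continuous fun t : ℝ => u (max t 0) :=
      hu.comp_continuous (by fun_prop) fun t => le_max_right t 0
    let a : ℝ → ℂ := fun t => l (G ζ (u (max t 0)))
    let b : ℝ → ℂ := fun t => l (C (u (max t 0)))
    have ha : Continuous a := l.continuous.comp ((G ζ).continuous.comp hmax)
    have hb : Continuous b := l.continuous.comp (C.continuous.comp hmax)
    have hint : ∀ (m : E →L[ℂ] ℂ) (φ : 𝒯),
        ∫ t in Ici (0 : ℝ), φ t * m (u (max t 0)) = m (G φ x) := by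
      intro m φ
      rw [← (hG φ m).2]
      refine setIntegral_congr_fun measurableSet_Ici fun t ht => ?_
      simp [max_eq_left (show (0 : ℝ) ≤ t from ht)]
    have hA : ∀ φ : 𝒯, ∫ t in Ici (0 : ℝ), φ t * a t = l (G ζ (G φ x)) := fun φ =>
      hint (l.comp (G ζ)) φ
    let A : ℝ → ℂ := fun s => ∫ r in Ici (0 : ℝ), ζ r * b (s + r)
    have hAc : Continuous A := continuous_integral_mul_add (continuous ζ) (hasCompactSupport ζ) hb
    have hB : ∀ φ χ : 𝒯, ⇑χ = conv₀ φ ζ → ∫ s in Ici (0 : ℝ), φ s * A s = l (G χ (C x)) := by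
      intro φ χ hχ
      rw [← integral_conv₀_mul (continuous φ) (hasCompactSupport φ) (continuous ζ)
        (hasCompactSupport ζ) hb, ← hχ, hC.apply]
      exact hint (l.comp C) χ
    have hi : ∀ (φ : 𝒯) {f : ℝ → ℂ}, Continuous f →
        IntegrableOn (fun t => φ t * f t) (Ici 0) := fun φ f hf =>
      (((continuous φ).mul hf).integrable_of_hasCompactSupport
        ((hasCompactSupport φ).mul_right)).integrableOn
    have haA : ∀ t, 0 ≤ t → a t - A t = 0 := by
      refine eq_zero_of_forall_integral_mul_eq_zero hφ₀ hne (f := fun t => a t - A t)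
        (ha.sub hAc) fun φ hφ => ?_
      obtain ⟨χ, hχ⟩ := exists_conv₀ φ ζ
      simp only [mul_sub]
      rw [integral_sub (hi φ ha) (hi φ hAc), hA, hB φ χ hχ,
        h1.apply hζ hφ (hχ.trans (conv₀_comm _ _)), sub_self]
    rw [← hB ψ χ hχ, ← hA]
    refine setIntegral_congr_fun measurableSet_Ici fun t ht => ?_
    rw [sub_eq_zero.1 (haA t ht)]
  · refine h2.eq_of_forall_apply_eq fun η hη => ?_
    have : η = 0 := DFunLike.coe_injective
      ((not_not.1 fun h => hne ⟨η, hη, h⟩).trans coe_zero.symm)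
    simp [this]

theorem D4.cs1 [T2Space E] [SeparatingDual ℂ E] {G : 𝒯 →L[ℂ] (E →L[ℂ] E)} {C : E →L[ℂ] E}
    (h4 : D4 G C) (hC : Commutes G C) (h1 : D1 G C) (h2 : CS2 G) (h3 : D3 G) : CS1 G C := by
  refine cs1_of_forall_testNonneg hC h2 fun ψ η hη χ hχ x => ?_
  exact congrFun (Continuous.ext_on h3 ((G χ).continuous.comp C.continuous)
    ((G η).continuous.comp (G ψ).continuous)
    fun y hy => h4.apply_apply_of_mem_range hC h1 h2 hη hχ hy) x

theorem CS1.d4 {G : 𝒯 →L[ℂ] (E →L[ℂ] E)} {C : E →L[ℂ] E} (h : CS1 G C) (hC : Commutes G C) :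
    D4 G C := by
  rintro _ ⟨ζ, hζ, y, rfl⟩
  choose τ hτ using fun a => exists_translate ζ a
  have hu : Continuous fun s => G (τ s) (C y) :=
    (continuous_eval_const (C y)).comp (G.continuous.comp (continuous_translate hτ))
  refine ⟨fun s => G (τ s) (C y), hu.continuousOn, ?_, fun φ l => ?_⟩
  · have : τ 0 = ζ := DFunLike.coe_injective (by rw [hτ]; simp)
    simp only [this, hC.apply]
  have hW : Continuous fun s => l (G (τ s) (C y)) := l.continuous.comp hu
  simp only [map_smul, smul_eq_mul]
  refine ⟨(((continuous φ).mul hW).integrable_of_hasCompactSupport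
    ((hasCompactSupport φ).mul_right)).integrableOn, ?_⟩
  obtain ⟨χ, hχ⟩ := exists_conv₀ φ ζ
  obtain ⟨R₁, hR₁, h₁⟩ := exists_radius (hasCompactSupport φ)
  obtain ⟨R₂, hR₂, h₂⟩ := exists_radius (hasCompactSupport ζ)
  have hR : 0 ≤ max R₁ R₂ := hR₁.le.trans (le_max_left _ _)
  have k₁ : ∀ t, max R₁ R₂ < |t| → φ t = 0 := fun t ht => h₁ t ((le_max_left _ _).trans_lt ht)
  have k₂ : ∀ t, max R₁ R₂ < |t| → ζ t = 0 := fun t ht => h₂ t ((le_max_right _ _).trans_lt ht)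
  have hΛ : Continuous fun χ : 𝒯 => l (G χ (C y)) :=
    l.continuous.comp ((continuous_eval_const (C y)).comp G.continuous)
  have lim₁ := (hΛ.tendsto χ).comp (tendsto_sum_riemannWeight_smul hζ hχ hτ hR k₁ k₂)
  have lim₂ := tendsto_riemannSum (continuous φ) hW hR
  -- The same scalar Riemann sums converge both to the integral and, through continuity of `𝒢`, to
  -- `l (G χ (C y))`.
  rw [setIntegral_Ici_eq_intervalIntegral hR fun t ht => by rw [k₁ t ht, zero_mul],
    ← h.apply hχ y]
  refine tendsto_nhds_unique lim₂ (lim₁.congr fun n => ?_)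
  simp [map_sum]

/-- The three assertions of the main theorem, for a space of test functions. -/
theorem testSpace_main [T2Space E] [SeparatingDual ℂ E] (C : E →L[ℂ] E) :
    (∀ G : 𝒯 →L[ℂ] (E →L[ℂ] E), SupportedNonneg G → BoundedlyEquicontinuous G → Commutes G C →
      (IsCSemigroup G C ↔ D1 G C ∧ D2 G ∧ D5 G C)) ∧
    (∀ G : 𝒯 →L[ℂ] (E →L[ℂ] E), SupportedNonneg G → BoundedlyEquicontinuous G → Commutes G C →
      D1 G C → D2 G → D3 G → D4 G C → IsCSemigroup G C) ∧
    (∀ G : 𝒯 →L[ℂ] (E →L[ℂ] E), IsCSemigroup G C → D4 G C) :=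
  ⟨fun _ hs hb hC => ⟨fun h => ⟨h.cs1.d1, h.cs2, h.cs1.d5 h.cs2⟩,
    fun h => ⟨hs, hC, hb, h.2.2.cs1 hC h.2.1, h.2.1⟩⟩,
    fun _ hs hb hC h1 h2 h3 h4 => ⟨hs, hC, hb, h4.cs1 hC h1 h2 h3, h2⟩,
    fun _ h => h.cs1.d4 h.commutes⟩

end

/-- Continuous complex linear forms separate the points of a Hausdorff locally convex space. -/
theorem separatingDual_complex {E : Type*} [AddCommGroup E] [Module ℂ E] [UniformSpace E]
    [IsUniformAddGroup E] [ContinuousSMul ℂ E] [LocallyConvexSpace ℝ E] [T2Space E] :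
    SeparatingDual ℂ E := by
  have : ContinuousSMul ℝ E := IsScalarTower.continuousSMul ℂ
  exact ⟨fun x hx => (RCLike.geometric_hahn_banach_point_point (𝕜 := ℂ) hx).imp
    fun f hf hf' => by simp [hf'] at hf⟩


/-! ### The Schwartz space `𝒟` -/

/-- A smooth function with compact support, as an element of `𝒟`. -/
def testFunctionMk (f : ℝ → ℂ) (hf : ContDiff ℝ ∞ f) (hc : HasCompactSupport f) :
    𝓓((⊤ : TopologicalSpace.Opens ℝ), ℂ) :=
  ⟨f, hf, hc, fun _ _ => trivial⟩

/-- Convergence is proved in the space of functions supported in `K`, which embeds continuously;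
each seminorm there involves one order, so the growth of `S` is irrelevant. -/
theorem testFunction_tendsto (χ : ℕ → 𝓓((⊤ : TopologicalSpace.Opens ℝ), ℂ))
    (χ₀ : 𝓓((⊤ : TopologicalSpace.Opens ℝ), ℂ)) (K : Set ℝ) (hK : IsCompact K)
    (hχ : ∀ n, tsupport (χ n) ⊆ K) (hχ₀ : tsupport χ₀ ⊆ K) (S : ℕ → ℝ) (ε : ℕ → ℝ)
    (hε : Tendsto ε atTop (𝓝 0))
    (h : ∀ n p t, ‖iteratedDeriv p (χ n) t - iteratedDeriv p χ₀ t‖ ≤ ε n * S (p + 1)) :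
    Tendsto χ atTop (𝓝 χ₀) := by
  let K' : TopologicalSpace.Compacts ℝ := ⟨K, hK⟩
  let f : ℕ → 𝓓_{K'}(ℝ, ℂ) := fun n =>
    .of_support_subset (χ n).contDiff ((subset_tsupport _).trans (hχ n))
  let f₀ : 𝓓_{K'}(ℝ, ℂ) := .of_support_subset χ₀.contDiff ((subset_tsupport _).trans hχ₀)
  have hK' : (K' : Set ℝ) ⊆ (⊤ : TopologicalSpace.Opens ℝ) := fun _ _ => trivial
  have hf : Tendsto f atTop (𝓝 f₀) := by
    rw [(ContDiffMapSupportedIn.withSeminorms ℝ ℝ ℂ ⊤ K').tendsto_nhds]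
    intro p δ hδ
    have h0 : Tendsto (fun n => |ε n * S (p + 1)|) atTop (𝓝 0) := by
      simpa using (hε.mul_const (S (p + 1))).abs
    filter_upwards [h0.eventually_lt_const hδ] with n hn
    refine lt_of_le_of_lt ?_ hn
    rw [ContDiffMapSupportedIn.seminorm_top_le_iff ℝ (abs_nonneg _)]
    intro t _
    rw [norm_iteratedFDeriv_eq_norm_iteratedDeriv]
    change ‖iteratedDeriv p (⇑(χ n) - ⇑χ₀) t‖ ≤ _
    have hp : ((p : ℕ∞) : WithTop ℕ∞) ≤ ∞ := by exact_mod_cast le_top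
    rw [iteratedDeriv_sub ((χ n).contDiff.of_le hp).contDiffAt (χ₀.contDiff.of_le hp).contDiffAt]
    exact (h n p t).trans (le_abs_self _)
  have := ((TestFunction.continuous_ofSupportedIn hK').tendsto f₀).comp hf
  exact this

instance : TestSpace 𝓓((⊤ : TopologicalSpace.Opens ℝ), ℂ) where
  coe_add _ _ := rfl
  coe_smul _ _ := rfl
  contDiff φ := φ.contDiff
  hasCompactSupport φ := φ.hasCompactSupport
  exists_translate φ a := ⟨testFunctionMk (fun t => φ (t - a))
    (φ.contDiff.comp (contDiff_id.sub contDiff_const))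
    (φ.hasCompactSupport.comp_homeomorph (Homeomorph.subRight a)), rfl⟩
  exists_id_mul φ := ⟨testFunctionMk (fun t => (t : ℂ) * φ t)
    (Complex.ofRealCLM.contDiff.mul φ.contDiff) φ.hasCompactSupport.mul_left, rfl⟩
  exists_conv₀ φ ψ := ⟨testFunctionMk (conv₀ φ ψ) (contDiff_conv₀ φ.contDiff ψ.contDiff)
    (hasCompactSupport_conv₀ φ.hasCompactSupport ψ.hasCompactSupport), rfl⟩
  tendsto_of_norm_iteratedDeriv_sub_le χ χ₀ ζ K hK hχ hχ₀ ε hε h := by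
    have hB : ∀ p, ∃ B, ∀ t, ‖iteratedDeriv p ζ t‖ ≤ B := fun p =>
      (ζ.contDiff.continuous_iteratedDeriv p
        (by exact_mod_cast le_top)).bounded_above_of_compact_support
          (hasCompactSupport_iteratedDeriv ζ.hasCompactSupport p)
    choose S hS using hB
    exact testFunction_tendsto χ χ₀ K hK hχ hχ₀ S ε hε (h S hS)


/-! ### The ultradifferentiable test functions -/

namespace IsWeightSequence

variable {M : ℕ → ℝ}

/-- The terms of the convergent series in (M.3)' are bounded. -/
theorem exists_le_mul_succ (hM : IsWeightSequence M) : ∃ c > 0, ∀ p, M p ≤ c * M (p + 1) := by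
  obtain ⟨B, hB⟩ := hM.nonQuasiAnalytic.tendsto_atTop_zero.bddAbove_range
  refine ⟨B, ?_, fun p => ?_⟩
  · exact (div_pos (hM.pos 0) (hM.pos 1)).trans_le (hB (mem_range_self 0))
  · exact (div_le_iff₀ (hM.pos _)).1 (hB (mem_range_self p))

theorem ratio_mono (hM : IsWeightSequence M) : Monotone fun p => M (p + 1) / M p := by
  refine monotone_nat_of_le_succ fun p => ?_
  rw [div_le_div_iff₀ (hM.pos _) (hM.pos _)]
  nlinarith [hM.logConvex p]

/-- By log-convexity the ratios of consecutive terms increase, and `M 0 = 1` starts the induction.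
-/
theorem mul_le_add (hM : IsWeightSequence M) (i j : ℕ) : M i * M j ≤ M (i + j) := by
  induction i with
  | zero => simp [hM.zero]
  | succ i ih =>
    have h1 : M (i + 1) = M (i + 1) / M i * M i := (div_mul_cancel₀ _ (hM.pos i).ne').symm
    have h2 : M (i + j + 1) = M (i + j + 1) / M (i + j) * M (i + j) :=
      (div_mul_cancel₀ _ (hM.pos _).ne').symm
    rw [h1, mul_assoc, Nat.add_right_comm, h2]
    exact mul_le_mul (hM.ratio_mono (Nat.le_add_right i j)) ih
      (mul_nonneg (hM.pos _).le (hM.pos _).le) (div_nonneg (hM.pos _).le (hM.pos _).le)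

end IsWeightSequence

/-! ### Ultradifferentiability of products with `t`, truncated convolutions and translates -/

theorem ultraNorm_le {M : ℕ → ℝ} (hM : ∀ p, 0 < M p) {h N : ℝ} (hh : 0 < h) {φ : ℝ → ℂ}
    (H : ∀ p t, ‖iteratedDeriv p φ t‖ ≤ N * (M p / h ^ p)) :
    ultraNorm M h φ ≤ ENNReal.ofReal N := by
  refine iSup₂_le fun p t => ?_
  have hMp := hM p
  rw [← ofReal_norm, ← ENNReal.ofReal_mul (by positivity)]
  refine ENNReal.ofReal_le_ofReal ?_
  calc h ^ p / M p * ‖iteratedDeriv p φ t‖ ≤ h ^ p / M p * (N * (M p / h ^ p)) := by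
        gcongr
        exact H p t
    _ = N := by field_simp

theorem ultraNorm_lt_top_iff {M : ℕ → ℝ} (hM : ∀ p, 0 < M p) {h : ℝ} (hh : 0 < h) {φ : ℝ → ℂ} :
    ultraNorm M h φ < ⊤ ↔ ∃ N ≥ 0, ∀ p t, ‖iteratedDeriv p φ t‖ ≤ N * (M p / h ^ p) := by
  refine ⟨fun H => ⟨(ultraNorm M h φ).toReal, ENNReal.toReal_nonneg, fun p t => ?_⟩,
    fun ⟨N, _, H⟩ => (ultraNorm_le hM hh H).trans_lt ENNReal.ofReal_lt_top⟩
  have h1 := le_iSup₂ (f := fun p t => ENNReal.ofReal (h ^ p / M p) * ‖iteratedDeriv p φ t‖ₑ) p t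
  have hMp := hM p
  rw [← ofReal_norm, ← ENNReal.ofReal_mul (by positivity)] at h1
  have h2 : h ^ p / M p * ‖iteratedDeriv p φ t‖ ≤ (ultraNorm M h φ).toReal :=
    (ENNReal.ofReal_le_iff_le_toReal H.ne).1 h1
  have h3 : ‖iteratedDeriv p φ t‖ = h ^ p / M p * ‖iteratedDeriv p φ t‖ * (M p / h ^ p) := by
    field_simp
  rw [h3]
  gcongr

/-- Boundedness of `χ` follows from that of `φ` and `ψ` if a bound for the latter yields one for the
former, up to a constant factor in the parameter `h`. -/
theorem UltraBounded.of_imp₂ {M : ℕ → ℝ} (hM : ∀ p, 0 < M p) {κ : UltraClass} {φ ψ χ : ℝ → ℂ}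
    {c : ℝ} (hc : 0 < c) (hφ : UltraBounded M φ κ) (hψ : UltraBounded M ψ κ)
    (H : ∀ h > 0, ∀ N₁ ≥ 0, ∀ N₂ ≥ 0, (∀ p t, ‖iteratedDeriv p φ t‖ ≤ N₁ * (M p / h ^ p)) →
      (∀ p t, ‖iteratedDeriv p ψ t‖ ≤ N₂ * (M p / h ^ p)) →
      ∃ N ≥ 0, ∀ p t, ‖iteratedDeriv p χ t‖ ≤ N * (M p / (h / c) ^ p)) :
    UltraBounded M χ κ := by
  have key : ∀ h > 0, ultraNorm M h φ < ⊤ → ultraNorm M h ψ < ⊤ → ultraNorm M (h / c) χ < ⊤ := by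
    intro h hh h1 h2
    obtain ⟨N₁, hN₁, k1⟩ := (ultraNorm_lt_top_iff hM hh).1 h1
    obtain ⟨N₂, hN₂, k2⟩ := (ultraNorm_lt_top_iff hM hh).1 h2
    exact (ultraNorm_lt_top_iff hM (div_pos hh hc)).2 (H h hh N₁ hN₁ N₂ hN₂ k1 k2)
  cases κ
  · intro h hh
    have := key (h * c) (mul_pos hh hc) (hφ _ (mul_pos hh hc)) (hψ _ (mul_pos hh hc))
    rwa [mul_div_cancel_right₀ _ hc.ne'] at this
  · obtain ⟨h, hh, h1⟩ := hφ
    obtain ⟨k, hk, k1⟩ := hψ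
    have hm : 0 < min h k := lt_min hh hk
    exact ⟨min h k / c, div_pos hm hc, key _ hm
      ((ultraNorm_mono hM hm.le (min_le_left _ _) _).trans_lt h1)
      ((ultraNorm_mono hM hm.le (min_le_right _ _) _).trans_lt k1)⟩

theorem iteratedDeriv_id_mul {φ : ℝ → ℂ} (hφ : ContDiff ℝ ∞ φ) (p : ℕ) (t : ℝ) :
    iteratedDeriv p (fun t : ℝ => (t : ℂ) * φ t) t =
      t * iteratedDeriv p φ t + p * iteratedDeriv (p - 1) φ t := by
  induction p generalizing φ with
  | zero => simp
  | succ p ih =>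
    have hφ' : ContDiff ℝ ∞ (deriv φ) := (contDiff_infty_iff_deriv.1 hφ).2
    have hd : deriv (fun t : ℝ => (t : ℂ) * φ t) = φ + fun t : ℝ => (t : ℂ) * deriv φ t := by
      funext s
      have h1 : HasDerivAt (fun t : ℝ => (t : ℂ)) 1 s := Complex.ofRealCLM.hasDerivAt
      have h2 := ((contDiff_infty.1 hφ 1).differentiable one_ne_zero s).hasDerivAt
      exact (h1.mul h2).deriv.trans (by simp)
    have hc : ContDiff ℝ ∞ fun t : ℝ => (t : ℂ) * deriv φ t := Complex.ofRealCLM.contDiff.mul hφ'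
    rw [iteratedDeriv_succ', hd, iteratedDeriv_add ((contDiff_infty.1 hφ p).contDiffAt)
      ((contDiff_infty.1 hc p).contDiffAt), ih hφ', ← iteratedDeriv_succ', Nat.add_sub_cancel]
    cases p with
    | zero => simp [add_comm]
    | succ p =>
      rw [Nat.add_sub_cancel, ← iteratedDeriv_succ']
      push_cast
      ring

theorem iteratedDeriv_eq_zero_of_radius {φ : ℝ → ℂ} {R : ℝ} (h : ∀ t, R < |t| → φ t = 0) (p : ℕ)
    {t : ℝ} (ht : R < |t|) : iteratedDeriv p φ t = 0 := by
  have h2 : EqOn φ 0 {t | R < |t|} := fun t ht => h t ht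
  rw [h2.iteratedDeriv_of_isOpen (isOpen_lt continuous_const continuous_abs) p ht]
  exact iteratedDeriv_const_zero

theorem natCast_le_two_pow (p : ℕ) : (p : ℝ) ≤ 2 ^ p := by exact_mod_cast Nat.lt_two_pow_self.le

/-- The loss of one derivative and a factor `p` is absorbed by halving `h`. -/
theorem IsWeightSequence.natCast_mul_pred_le {M : ℕ → ℝ} {c : ℝ} (hM : IsWeightSequence M)
    (hc : ∀ p, M p ≤ c * M (p + 1)) {h : ℝ} (hh : 0 < h) (p : ℕ) :
    p * (M (p - 1) / h ^ (p - 1)) ≤ c * h * (M p / (h / 2) ^ p) := by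
  cases p with
  | zero =>
    have hc0 : 0 < c := pos_of_mul_pos_left ((hM.pos 0).trans_le (hc 0)) (hM.pos 1).le
    have := hM.pos 0
    simp only [Nat.cast_zero, zero_mul]
    positivity
  | succ p =>
    rw [Nat.add_sub_cancel]
    have hMp := hM.pos p
    calc ((p + 1 : ℕ) : ℝ) * (M p / h ^ p) ≤ 2 ^ (p + 1) * (c * M (p + 1) / h ^ p) := by
          gcongr
          · exact natCast_le_two_pow _
          · exact hc p
      _ = c * h * (M (p + 1) / (h / 2) ^ (p + 1)) := by
          rw [div_pow, pow_succ h]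
          field_simp

theorem div_pow_le_div_half_pow {m h : ℝ} (hm : 0 < m) (hh : 0 < h) (p : ℕ) :
    m / h ^ p ≤ m / (h / 2) ^ p := by
  gcongr
  linarith

theorem ultraBounded_id_mul (M : Weight) {κ : UltraClass} {φ : ℝ → ℂ} (hφ : ContDiff ℝ ∞ φ)
    (hc : HasCompactSupport φ) (hb : UltraBounded M.seq φ κ) :
    UltraBounded M.seq (fun t : ℝ => (t : ℂ) * φ t) κ := by
  obtain ⟨R, hR, hR0⟩ := exists_radius hc
  obtain ⟨c, hc0, hc⟩ := M.isWeight.exists_le_mul_succ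
  refine UltraBounded.of_imp₂ M.isWeight.pos two_pos hb hb fun h hh N hN _ _ H _ =>
    ⟨R * N + N * (c * h), by positivity, fun p t => ?_⟩
  have hMp := M.isWeight.pos p
  rw [iteratedDeriv_id_mul hφ]
  refine (norm_add_le _ _).trans ?_
  rw [add_mul]
  refine add_le_add ?_ ?_
  · by_cases ht : R < |t|
    · rw [iteratedDeriv_eq_zero_of_radius hR0 p ht, mul_zero, norm_zero]
      positivity
    · rw [norm_mul, Complex.norm_real, Real.norm_eq_abs, mul_assoc]
      refine mul_le_mul (not_lt.1 ht) ((H p t).trans ?_) (norm_nonneg _) hR.le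
      gcongr _ * ?_
      exact div_pow_le_div_half_pow hMp hh p
  · rw [norm_mul, Complex.norm_natCast, mul_assoc N]
    calc (p : ℝ) * ‖iteratedDeriv (p - 1) φ t‖ ≤ p * (N * (M.seq (p - 1) / h ^ (p - 1))) := by
          gcongr
          exact H _ t
      _ = N * (p * (M.seq (p - 1) / h ^ (p - 1))) := by ring
      _ ≤ _ := by
          gcongr _ * ?_
          exact M.isWeight.natCast_mul_pred_le hc hh p

theorem norm_conv₀_le {f g : ℝ → ℂ} {B : ℝ} (hB : ∀ t, ‖f t‖ ≤ B) (hg : Integrable g) (t : ℝ) :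
    ‖conv₀ f g t‖ ≤ B * ∫ s, ‖g s‖ := by
  refine intervalIntegral.norm_integral_le_integral_norm_uIoc.trans ?_
  rw [← integral_const_mul]
  have hB0 : 0 ≤ B := (norm_nonneg _).trans (hB 0)
  calc ∫ s in uIoc 0 t, ‖f (t - s) * g s‖ ≤ ∫ s in uIoc 0 t, B * ‖g s‖ := by
        refine integral_mono_of_nonneg (Eventually.of_forall fun s => norm_nonneg _)
          (hg.norm.const_mul B).integrableOn (Eventually.of_forall fun s => ?_)
        simp only [norm_mul]
        gcongr
        exact hB _
    _ ≤ ∫ s, B * ‖g s‖ :=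
        setIntegral_le_integral (hg.norm.const_mul B) (Eventually.of_forall fun s => by positivity)

/-- Each of the `n` boundary terms is controlled by `M k * M (n - 1 - k) ≤ M (n - 1)`; halving `h`
absorbs the factor `n` and the index shift. -/
theorem ultraBounded_conv₀ (M : Weight) {κ : UltraClass} {φ ψ : ℝ → ℂ} (hφ : ContDiff ℝ ∞ φ)
    (hφb : UltraBounded M.seq φ κ) (hψ : ContDiff ℝ ∞ ψ)
    (hψc : HasCompactSupport ψ) (hψb : UltraBounded M.seq ψ κ) :
    UltraBounded M.seq (conv₀ φ ψ) κ := by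
  obtain ⟨c, hc0, hc⟩ := M.isWeight.exists_le_mul_succ
  have hψi : Integrable ψ := hψ.continuous.integrable_of_hasCompactSupport hψc
  have hI : 0 ≤ ∫ s, ‖ψ s‖ := integral_nonneg fun _ => norm_nonneg _
  refine UltraBounded.of_imp₂ M.isWeight.pos two_pos hφb hψb fun h hh N₁ hN₁ N₂ hN₂ H₁ H₂ =>
    ⟨N₁ * (∫ s, ‖ψ s‖) + N₁ * N₂ * (c * h), by positivity, fun n t => ?_⟩
  have hMn := M.isWeight.pos n
  rw [iteratedDeriv_conv₀ hφ hψ]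
  refine (norm_add_le _ _).trans ?_
  rw [add_mul]
  refine add_le_add ?_ ?_
  · refine (norm_conv₀_le (H₁ n) hψi t).trans ?_
    rw [mul_right_comm]
    exact mul_le_mul_of_nonneg_left (div_pow_le_div_half_pow hMn hh n) (by positivity)
  · calc ‖∑ k ∈ Finset.range n, iteratedDeriv k φ 0 * iteratedDeriv (n - 1 - k) ψ t‖
        ≤ ∑ k ∈ Finset.range n, N₁ * N₂ * (M.seq (n - 1) / h ^ (n - 1)) := by
          refine norm_sum_le_of_le _ fun k hk => ?_
          have hk' : k + (n - 1 - k) = n - 1 := by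
            have := Finset.mem_range.1 hk
            omega
          have hMk := M.isWeight.pos k
          rw [norm_mul]
          calc ‖iteratedDeriv k φ 0‖ * ‖iteratedDeriv (n - 1 - k) ψ t‖
              ≤ N₁ * (M.seq k / h ^ k) * (N₂ * (M.seq (n - 1 - k) / h ^ (n - 1 - k))) := by
                gcongr
                · exact H₁ _ _
                · exact H₂ _ _
            _ = N₁ * N₂ * (M.seq k * M.seq (n - 1 - k) / h ^ (k + (n - 1 - k))) := by
                rw [pow_add]
                field_simp
            _ ≤ N₁ * N₂ * (M.seq (n - 1) / h ^ (n - 1)) := by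
                rw [hk']
                gcongr
                exact (M.isWeight.mul_le_add _ _).trans_eq (by rw [hk'])
      _ = N₁ * N₂ * (n * (M.seq (n - 1) / h ^ (n - 1))) := by
          rw [Finset.sum_const, Finset.card_range, nsmul_eq_mul]
          ring
      _ ≤ N₁ * N₂ * (c * h) * (M.seq n / (h / 2) ^ n) := by
          rw [mul_assoc (N₁ * N₂)]
          gcongr _ * ?_
          exact M.isWeight.natCast_mul_pred_le hc hh n

theorem ultraBounded_translate (M : Weight) {κ : UltraClass} {φ : ℝ → ℂ}
    (hb : UltraBounded M.seq φ κ) (a : ℝ) : UltraBounded M.seq (fun t => φ (t - a)) κ := by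
  refine UltraBounded.of_imp₂ M.isWeight.pos one_pos hb hb fun h _ N hN _ _ H _ =>
    ⟨N, hN, fun p t => ?_⟩
  rw [iteratedDeriv_comp_sub_const, div_one]
  exact H _ _

namespace UltraTestFunction

variable {κ : UltraClass} {M : Weight}

/-- In the Beurling case the seminorm dictates `h`, so every `h > 0` must be handled; in the Roumieu
case it is continuous on every step, so one `h₀` suffices. -/
theorem tendsto_of_ultraNorm_sub_le {χ : ℕ → UltraTestFunction κ M} {χ₀ : UltraTestFunction κ M}
    {K : Set ℝ} (hK : IsCompact K) (hχ : ∀ n, tsupport (χ n) ⊆ K) (hχ₀ : tsupport χ₀ ⊆ K)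
    {ε : ℕ → ℝ} (hε : Tendsto ε atTop (𝓝 0)) {h₀ : ℝ} (hh₀ : 0 < h₀)
    (H : ∀ h, (κ = .beurling → 0 < h) → (κ = .roumieu → h = h₀) →
      ∃ N : ℝ, ∀ n, ultraNorm M.seq h (χ n - χ₀) ≤ ENNReal.ofReal (|ε n| * N)) :
    Tendsto χ atTop (𝓝 χ₀) := by
  have hsupp : ∀ n, tsupport (χ n - χ₀ : UltraTestFunction κ M) ⊆ K := fun n =>
    (tsupport_sub _ _).trans (union_subset (hχ n) hχ₀)
  rw [(withSeminorms κ M).tendsto_nhds]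
  rintro ⟨q, hq⟩ δ hδ
  obtain ⟨h, c, hc⟩ : ∃ N : ℝ, ∃ c : ℝ≥0, ∀ n, ENNReal.ofReal (q (χ n - χ₀)) ≤
      c * ENNReal.ofReal (|ε n| * N) := by
    cases κ
    · obtain ⟨h, hh, c, hc⟩ := hq K hK
      obtain ⟨N, hN⟩ := H h (fun _ => hh) (fun h => by cases h)
      exact ⟨N, c, fun n => (hc _ (hsupp n)).trans (by gcongr; exact hN n)⟩
    · obtain ⟨c, hc⟩ := hq K hK h₀ hh₀
      obtain ⟨N, hN⟩ := H h₀ (fun _ => hh₀) (fun _ => rfl)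
      exact ⟨N, c, fun n => (hc _ (hsupp n) ((hN n).trans_lt ENNReal.ofReal_lt_top)).trans
        (by gcongr; exact hN n)⟩
  have hlim : Tendsto (fun n => (c : ENNReal) * ENNReal.ofReal (|ε n| * h)) atTop (𝓝 0) := by
    have h1 : Tendsto (fun n => |ε n| * h) atTop (𝓝 0) := by simpa using hε.abs.mul_const h
    have h2 := ENNReal.tendsto_ofReal h1
    rw [ENNReal.ofReal_zero] at h2
    simpa using ENNReal.Tendsto.const_mul h2 (Or.inr ENNReal.coe_ne_top)
  filter_upwards [hlim.eventually_lt_const (ENNReal.ofReal_pos.2 hδ)] with n hn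
  exact (ENNReal.ofReal_lt_ofReal_iff hδ).1 ((hc n).trans_lt hn)

/-- The lost derivative is recovered from (M.2) with `q = 1`: a bound for `ζ` with parameter `L * h`
controls the differences with parameter `h`. -/
theorem tendsto_of_norm_iteratedDeriv_sub_le (χ : ℕ → UltraTestFunction κ M)
    (χ₀ ζ : UltraTestFunction κ M) (K : Set ℝ) (hK : IsCompact K) (hχ : ∀ n, tsupport (χ n) ⊆ K)
    (hχ₀ : tsupport χ₀ ⊆ K) (ε : ℕ → ℝ) (hε : Tendsto ε atTop (𝓝 0))
    (H : ∀ S : ℕ → ℝ, (∀ p t, ‖iteratedDeriv p ζ t‖ ≤ S p) → ∀ n p t,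
      ‖iteratedDeriv p (χ n) t - iteratedDeriv p χ₀ t‖ ≤ ε n * S (p + 1)) :
    Tendsto χ atTop (𝓝 χ₀) := by
  have hM := M.isWeight.pos
  obtain ⟨A, hA, L, hL, hst⟩ := M.isWeight.stable
  have key : ∀ h > 0, ultraNorm M.seq (L * h) ζ < ⊤ →
      ∃ N : ℝ, ∀ n, ultraNorm M.seq h (χ n - χ₀) ≤ ENNReal.ofReal (|ε n| * N) := by
    intro h hh hζ
    obtain ⟨N, hN, hζN⟩ := (ultraNorm_lt_top_iff hM (mul_pos hL hh)).1 hζ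
    refine ⟨N * A * M.seq 1 / h, fun n => ultraNorm_le hM hh fun p t => ?_⟩
    have hp : (p : WithTop ℕ∞) ≤ ∞ := by exact_mod_cast le_top
    have hMp := hM (p + 1)
    rw [iteratedDeriv_sub (f := χ n) (g := χ₀) ((χ n).2.1.of_le hp).contDiffAt
      (χ₀.2.1.of_le hp).contDiffAt]
    refine (H _ hζN n p t).trans ?_
    calc ε n * (N * (M.seq (p + 1) / (L * h) ^ (p + 1)))
        ≤ |ε n| * (N * (A * L ^ (p + 1) * (M.seq p * M.seq 1) / (L * h) ^ (p + 1))) := by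
          gcongr
          · exact le_abs_self _
          · exact hst p 1
      _ = |ε n| * (N * A * M.seq 1 / h) * (M.seq p / h ^ p) := by
          rw [mul_pow, pow_succ h]
          field_simp
  cases κ
  · exact tendsto_of_ultraNorm_sub_le hK hχ hχ₀ hε one_pos fun h hh _ =>
      key h (hh rfl) (ζ.2.2.2 _ (mul_pos hL (hh rfl)))
  · obtain ⟨h, hh, hζ⟩ := ζ.2.2.2
    refine tendsto_of_ultraNorm_sub_le hK hχ hχ₀ hε (div_pos hh hL) fun k _ hk => ?_
    rw [hk rfl]
    exact key _ (div_pos hh hL) (by rwa [mul_div_cancel₀ _ hL.ne'])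

instance : TestSpace (UltraTestFunction κ M) where
  coe_add _ _ := rfl
  coe_smul _ _ := rfl
  contDiff φ := φ.2.1
  hasCompactSupport φ := φ.2.2.1
  exists_translate φ a := ⟨⟨fun t => φ (t - a), φ.2.1.comp (contDiff_id.sub contDiff_const),
    φ.2.2.1.comp_homeomorph (Homeomorph.subRight a), ultraBounded_translate M φ.2.2.2 a⟩, rfl⟩
  exists_id_mul φ := ⟨⟨fun t => (t : ℂ) * φ t, Complex.ofRealCLM.contDiff.mul φ.2.1,
    φ.2.2.1.mul_left, ultraBounded_id_mul M φ.2.1 φ.2.2.1 φ.2.2.2⟩, rfl⟩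
  exists_conv₀ φ ψ := ⟨⟨conv₀ φ ψ, contDiff_conv₀ φ.2.1 ψ.2.1,
    hasCompactSupport_conv₀ φ.2.2.1 ψ.2.2.1,
    ultraBounded_conv₀ M φ.2.1 φ.2.2.2 ψ.2.1 ψ.2.2.1 ψ.2.2.2⟩, rfl⟩
  tendsto_of_norm_iteratedDeriv_sub_le := tendsto_of_norm_iteratedDeriv_sub_le

end UltraTestFunction


end CDS

theorem mainTheorem12 {E : Type*} [AddCommGroup E] [Module ℂ E] [UniformSpace E]
    [IsUniformAddGroup E] [ContinuousSMul ℂ E] [LocallyConvexSpace ℝ E] [T2Space E]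
    (hE : ∀ u : ℕ → E, CauchySeq u → ∃ a, Tendsto u atTop (𝓝 a))
    (C : E →L[ℂ] E) :
    -- distributions
    ((∀ G : 𝓓((⊤ : TopologicalSpace.Opens ℝ), ℂ) →L[ℂ] (E →L[ℂ] E),
        CDS.SupportedNonneg G → CDS.BoundedlyEquicontinuous G → CDS.Commutes G C →
          (CDS.IsCSemigroup G C ↔ CDS.D1 G C ∧ CDS.D2 G ∧ CDS.D5 G C)) ∧
      (∀ G : 𝓓((⊤ : TopologicalSpace.Opens ℝ), ℂ) →L[ℂ] (E →L[ℂ] E),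
        CDS.SupportedNonneg G → CDS.BoundedlyEquicontinuous G → CDS.Commutes G C →
          CDS.D1 G C → CDS.D2 G → CDS.D3 G → CDS.D4 G C → CDS.IsCSemigroup G C) ∧
      (∀ G : 𝓓((⊤ : TopologicalSpace.Opens ℝ), ℂ) →L[ℂ] (E →L[ℂ] E),
        CDS.IsCSemigroup G C → CDS.D4 G C)) ∧
    -- ultradistributions of Beurling and of Roumieu class
    (∀ (κ : CDS.UltraClass) (M : CDS.Weight),
      (∀ G : CDS.UltraTestFunction κ M →L[ℂ] (E →L[ℂ] E),
        CDS.SupportedNonneg G → CDS.BoundedlyEquicontinuous G → CDS.Commutes G C →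
          (CDS.IsCSemigroup G C ↔ CDS.D1 G C ∧ CDS.D2 G ∧ CDS.D5 G C)) ∧
      (∀ G : CDS.UltraTestFunction κ M →L[ℂ] (E →L[ℂ] E),
        CDS.SupportedNonneg G → CDS.BoundedlyEquicontinuous G → CDS.Commutes G C →
          CDS.D1 G C → CDS.D2 G → CDS.D3 G → CDS.D4 G C → CDS.IsCSemigroup G C) ∧
      (∀ G : CDS.UltraTestFunction κ M →L[ℂ] (E →L[ℂ] E),
        CDS.IsCSemigroup G C → CDS.D4 G C)) := by
  have := CDS.separatingDual_complex (E := E)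
  exact ⟨CDS.testSpace_main C, fun κ M => CDS.testSpace_main C⟩
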